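/- Let $\Bbbk$ be a field of characteristic zero, let $\mathbf n=(n_1,\dots,n_d)$ be a tuple of natural numbers, let $\mathbf r=(r_1,\dots,r_m)$ be a tuple of integers with all $r_k\ge 2$, and put $R=r_1\cdots r_m$. Let $\mathcal S\subset \Bbbk^{n_1\times\cdots\times n_d}$ be the set of rank-$1$ tensors, $\mathcal S^*\subset\mathcal S$ the subset of those with all entries nonzero, and let $\circledast$ denote the Hadamard (entrywise) product. An $\mathbf r$-Hadamard--Hitchcock decomposition ($\mathbf r$-HHD) of a tensor $\mathcal T$ is a family $(\mathcal A_{k,i})_{1\le k\le m,\,1\le i\le r_k}$ of elements of $\mathcal S$ with $$\mathcal T=\Big(\sum_{i=1}^{r_1}\mathcal A_{1,i}\Big)\circledast\cdots\circledast\Big(\sum_{i=1}^{r_m}\mathcal A_{m,i}\Big),$$ considered up to permuting the summands inside each factor and permuting factors of equal length $r_k$. An essential $\mathbf r$-HHD of $\mathcal T$ is a class of $\mathbf r$-HHDs of $\mathcal T$ modulo the operations $\mathcal A_{k,i}\mapsto \mathcal D_k\circledast\mathcal A_{k,i}$ with $\mathcal D_1,\dots,\mathcal D_m\in\mathcal S^*$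 and $\mathcal D_1\circledast\cdots\circledast\mathcal D_m=\mathbf 1\otimes\cdots\otimes\mathbf 1$, the tensor filled with ones. The tensor $\mathcal T$ is $\mathbf r$-identifiable if it has exactly one essential $\mathbf r$-HHD. Let $\sigma^\circ_{\mathbf r}$ be the set of tensors admitting an $\mathbf r$-HHD and $\sigma_{\mathbf r}$ its Zariski closure in $\Bbbk^{n_1\times\cdots\times n_d}$. Suppose that there is a partition $\{1,\dots,d\}=I\sqcup J\sqcup K$ such that, with $\Pi_X:=\prod_{x\in X}n_x$ and $\delta:=\Pi_J+\Pi_K-\Pi_I-2$, $$\Pi_I\ge\Pi_J\ge\Pi_K\ge 2\qquad\text{and}\qquad R\le \Pi_I+\min\{\tfrac12\delta,\ \delta\}$$ (that is, $R$ lies in the range of applicability of the reshaped Kruskal criterion). Then a generic tensor admitting an $\mathbf r$-HHD has a unique essential $\mathbf r$-HHD: there is a Zariski closed set $\mathcal Z\subsetneq\sigma_{\mathbf r}$ such that every $\mathcal T\in\sigma^\circ_{\mathbf r}\setminus\mathcal Z$ is $\mathbf r$-identifiable. If moreover $\Bbbk$ is algebraically closed, then, for the same $\mathcal Z$, every $\mathcal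 T\in\sigma_{\mathbf r}\setminus\mathcal Z$ is $\mathbf r$-identifiable (in particular, it admits an $\mathbf r$-HHD). -/

import Mathlib

namespace HHD

/-- Tensors of shape `n 0 × ⋯ × n (d-1)`, as arrays of coordinates. The pointwise multiplication of
functions is the Hadamard product, and `1` is the tensor filled with ones. -/
abbrev Tensor (K : Type*) {d : ℕ} (n : Fin d → ℕ) : Type _ :=
  (∀ i : Fin d, Fin (n i)) → K

/-- The decomposable tensor `a 0 ⊗ ⋯ ⊗ a (d-1)`. -/
def outer {K : Type*} [Field K] {d : ℕ} {n : Fin d → ℕ} (a : ∀ i : Fin d, Fin (n i) → K) :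
    Tensor K n :=
  fun j => ∏ i, a i (j i)

/-- The set `S` of tensors of rank (exactly) one. -/
def segre (K : Type*) [Field K] {d : ℕ} (n : Fin d → ℕ) : Set (Tensor K n) :=
  {A | A ≠ 0 ∧ ∃ a : ∀ i : Fin d, Fin (n i) → K, A = outer a}

/-- The set `S*` of rank-one tensors all of whose entries are nonzero. -/
def segreStar (K : Type*) [Field K] {d : ℕ} (n : Fin d → ℕ) : Set (Tensor K n) :=
  {A | A ∈ segre K n ∧ ∀ j, A j ≠ 0}

/-- Ordered families `A k i` of tensors, with `r k` tensors in the `k`-th Hadamard factor. -/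
abbrev Family (K : Type*) {d m : ℕ} (n : Fin d → ℕ) (r : Fin m → ℕ) : Type _ :=
  ∀ k : Fin m, Fin (r k) → Tensor K n

/-- The ordered family `A` is an `r`-Hadamard–Hitchcock decomposition of `T`: all its members have
rank one, and `T` is the Hadamard product over `k` of the sums `∑ i, A k i`. -/
def IsHHD {K : Type*} [Field K] {d m : ℕ} {n : Fin d → ℕ} {r : Fin m → ℕ}
    (A : Family K n r) (T : Tensor K n) : Prop :=
  (∀ k i, A k i ∈ segre K n) ∧ T = ∏ k, ∑ i, A k i

/-- The tensors admitting an `r`-Hadamard–Hitchcock decomposition. -/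
def hhdTensors (K : Type*) [Field K] {d m : ℕ} (n : Fin d → ℕ) (r : Fin m → ℕ) :
    Set (Tensor K n) :=
  {T | ∃ A : Family K n r, IsHHD A T}

/-- Zariski closed subsets of an affine space. -/
def IsZariskiClosed {K ι : Type*} [Field K] (Z : Set (ι → K)) : Prop :=
  ∃ I : Ideal (MvPolynomial ι K), Z = MvPolynomial.zeroLocus K I

/-- The Zariski closure of a subset of an affine space. -/
def zariskiClosure {K ι : Type*} [Field K] (V : Set (ι → K)) : Set (ι → K) :=
  MvPolynomial.zeroLocus K (MvPolynomial.vanishingIdeal K V)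

/-- The variety of tensors admitting an `r`-Hadamard–Hitchcock decomposition. -/
def hhdVariety (K : Type*) [Field K] {d m : ℕ} (n : Fin d → ℕ) (r : Fin m → ℕ) :
    Set (Tensor K n) :=
  zariskiClosure (hhdTensors K n r)

/-- Two ordered families are identified if they differ by a permutation `ψ` of the Hadamard factors
that preserves `r` (this is what the existence of the bijections `π k` expresses) and by
permutations of the members of each factor. -/
def permSetoid (K : Type*) {d m : ℕ} (n : Fin d → ℕ) (r : Fin m → ℕ) :
    Setoid (Family K n r) where
  r A B := ∃ (ψ : Equiv.Perm (Fin m)) (π : ∀ k, Fin (r k) ≃ Fin (r (ψ k))),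
    ∀ k i, B k i = A (ψ k) (π k i)
  iseqv := by
    refine ⟨fun A => ⟨Equiv.refl _, fun k => Equiv.refl _, fun k i => rfl⟩, ?_, ?_⟩
    · rintro A B ⟨ψ, π, h⟩
      have aux : ∀ (k l : Fin m) (e : k = l) (i : Fin (r k)),
          A l (finCongr (congrArg r e) i) = A k i := by
        intro k l e i
        subst e
        rfl
      refine ⟨ψ.symm, fun k => (finCongr (congrArg r (ψ.apply_symm_apply k).symm)).trans
        (π (ψ.symm k)).symm, fun k i => ?_⟩
      rw [h, Equiv.trans_apply]
      exact ((congrArg (A (ψ (ψ.symm k))) (Equiv.apply_symm_apply _ _)).trans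
        (aux k _ (ψ.apply_symm_apply k).symm i)).symm
    · rintro A B C ⟨ψ, π, h⟩ ⟨ψ', π', h'⟩
      exact ⟨ψ'.trans ψ, fun k => (π' k).trans (π (ψ' k)), fun k i => by
        rw [h', h]; rfl⟩

/-- Families of tensors up to reordering inside the factors and reordering of factors of equal
length. -/
def UnorderedFamily (K : Type*) {d m : ℕ} (n : Fin d → ℕ) (r : Fin m → ℕ) : Type _ :=
  Quotient (permSetoid K n r)

/-- The class of an ordered family. -/
def Family.toUnordered {K : Type*} {d m : ℕ} {n : Fin d → ℕ} {r : Fin m → ℕ}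
    (A : Family K n r) : UnorderedFamily K n r :=
  Quotient.mk (permSetoid K n r) A

/-- The set of `r`-Hadamard–Hitchcock decompositions of `T`. -/
def hhds {K : Type*} [Field K] {d m : ℕ} {n : Fin d → ℕ} (r : Fin m → ℕ) (T : Tensor K n) :
    Set (UnorderedFamily K n r) :=
  {H | ∃ A : Family K n r, IsHHD A T ∧ Family.toUnordered A = H}

/-- The orbit of `H` under Hadamard multiplication of the factors by tensors
`D 0, …, D (m-1) ∈ S*` whose Hadamard product is the tensor of ones. -/
def starOrbit {K : Type*} [Field K] {d m : ℕ} {n : Fin d → ℕ} {r : Fin m → ℕ}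
    (H : UnorderedFamily K n r) : Set (UnorderedFamily K n r) :=
  {H' | ∃ (A : Family K n r) (D : Fin m → Tensor K n), Family.toUnordered A = H ∧
    (∀ k, D k ∈ segreStar K n) ∧ ∏ k, D k = 1 ∧
    H' = Family.toUnordered (fun k i => D k * A k i)}

/-- The set of essential `r`-Hadamard–Hitchcock decompositions of `T`. -/
def essentialHHDs {K : Type*} [Field K] {d m : ℕ} {n : Fin d → ℕ} (r : Fin m → ℕ)
    (T : Tensor K n) : Set (Set (UnorderedFamily K n r)) :=
  starOrbit '' hhds r T

/-- `T` is `r`-identifiable: it has exactly one essential `r`-Hadamard–Hitchcock decomposition. -/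
def Identifiable {K : Type*} [Field K] {d m : ℕ} {n : Fin d → ℕ} (r : Fin m → ℕ)
    (T : Tensor K n) : Prop :=
  ∃ E, essentialHHDs r T = {E}

/-- The product of the dimensions `n x`, for `x ∈ X`. -/
def dimProd {d : ℕ} (n : Fin d → ℕ) (X : Finset (Fin d)) : ℕ :=
  ∏ x ∈ X, n x

/-- The quantity `δ = Π_J + Π_K - Π_I - 2`. -/
def kruskalDelta {d : ℕ} (n : Fin d → ℕ) (I J K : Finset (Fin d)) : ℚ :=
  (dimProd n J : ℚ) + dimProd n K - dimProd n I - 2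

/-- `R` lies in the range of applicability of the reshaped Kruskal criterion for the shape `n`:
for some partition `I ⊔ J ⊔ K` of the modes with `Π_I ≥ Π_J ≥ Π_K ≥ 2`, one has
`R ≤ Π_I + min (δ / 2) δ`. -/
def InKruskalRange {d : ℕ} (n : Fin d → ℕ) (R : ℕ) : Prop :=
  ∃ I J K : Finset (Fin d),
    Disjoint I J ∧ Disjoint I K ∧ Disjoint J K ∧ I ∪ J ∪ K = Finset.univ ∧
    dimProd n J ≤ dimProd n I ∧ dimProd n K ≤ dimProd n J ∧ 2 ≤ dimProd n K ∧
    (R : ℚ) ≤ (dimProd n I : ℚ) + min (kruskalDelta n I J K / 2) (kruskalDelta n I J K)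

end HHD

/-!
Multiplying out a product of `m` sums of `r k` rank-one tensors gives `R = ∏ k, r k` rank-one terms.
For generic coordinates, any `min R Π_X` of the vectors that these terms contribute in a block `X`
of modes are linearly independent, as one sees by specializing to a Vandermonde matrix. Kruskal's
theorem for the blocks `I`, `J`, `K` then determines the terms up to a permutation of the
multi-indices. The product of the terms with multi-indices `i` and `j` depends only on the unordered
pairs `{i k, j k}`, and generically determines them; hence the permutation respects these pairs, and
so it comes from a permutation of the factors and permutations of the summands of each factor.
Two decompositions with the same terms differ by rank-one tensors `D k` with product one.

By Chevalley's theorem, every tensor of `σ_r` outside of a proper closed subset has a decomposition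
with generic coordinates over the algebraic closure of the ground field. Its terms are compared with
those of the decompositions over the ground field.
-/

namespace HHD

section Rank

open Module Submodule

variable {K ι V : Type*} [Field K] [AddCommGroup V] [Module K V]

theorem finrank_image_eq_card {x : ι → V} {S : Finset ι} (h : LinearIndepOn K x S) :
    (x '' S).finrank K = S.card := by
  have := finrank_span_eq_card h.linearIndependent
  rw [← Set.image_eq_range] at this
  exact this.trans (Fintype.card_coe S)

theorem finrank_image_le_card (x : ι → V) (S : Finset ι) : (x '' S).finrank K ≤ S.card := by
  classical
  have := finrank_span_finset_le_card (R := K) (S.image x)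
  rw [Finset.coe_image] at this
  exact this.trans Finset.card_image_le

theorem finrank_mkQ_image_add_finrank [FiniteDimensional K V] (A B : Set V) :
    ((span K A).mkQ '' B).finrank K + A.finrank K = (A ∪ B).finrank K := by
  set W := span K A
  set P := span K (A ∪ B) with hP
  have hWP : W ≤ P := span_mono Set.subset_union_left
  have h := (W.mkQ.domRestrict P).finrank_range_add_finrank_ker
  rw [LinearMap.range_domRestrict, LinearMap.ker_domRestrict, ker_mkQ,
    (comapSubtypeEquivOfLe hWP).finrank_eq, hP, span_union, Submodule.map_sup, mkQ_map_self,
    bot_sup_eq, map_span, ← span_union] at h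
  exact h

theorem finrank_union_of_disjoint [FiniteDimensional K V] {A B : Set V}
    (h : Disjoint (span K A) (span K B)) :
    (A ∪ B).finrank K = A.finrank K + B.finrank K := by
  have := finrank_sup_add_finrank_inf_eq (span K A) (span K B)
  rwa [h.eq_bot, finrank_bot, add_zero, ← span_union] at this

theorem finrank_union_lt_of_not_disjoint [FiniteDimensional K V] {A B : Set V}
    (h : ¬ Disjoint (span K A) (span K B)) :
    (A ∪ B).finrank K < A.finrank K + B.finrank K := by
  have hsum := finrank_sup_add_finrank_inf_eq (span K A) (span K B)
  rw [← span_union] at hsum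
  have hpos : 0 < finrank K (span K A ⊓ span K B : Submodule K V) :=
    Nat.pos_of_ne_zero fun h0 => h (disjoint_iff.2 (finrank_eq_zero.1 h0))
  simp only [Set.finrank]
  omega

/-- The maps `ψ ↦ (ψ (w a))_a` and `c ↦ ∑ a, c a • u a` compose to zero, and their ranks are those
of `w` and `u`. -/
theorem finrank_range_add_finrank_range_le_card {U : Type*} [AddCommGroup U] [Module K U]
    [Fintype ι] {u : ι → U} {w : ι → V}
    (h : ∀ ψ : Dual K V, ∑ a, ψ (w a) • u a = 0) :
    (Set.range u).finrank K + (Set.range w).finrank K ≤ Fintype.card ι := by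
  classical
  let F := Fintype.linearCombination K u
  let G := Fintype.linearCombination K w
  let e := (Pi.basisFun K ι).dualBasis.equivFun
  have hker : (LinearMap.range G.dualMap).map e.toLinearMap ≤ LinearMap.ker F := by
    rintro _ ⟨_, ⟨ψ, rfl⟩, rfl⟩
    simpa [F, G, e, Fintype.linearCombination_apply] using h ψ
  have hle := Submodule.finrank_mono hker
  rw [LinearEquiv.finrank_map_eq, LinearMap.finrank_range_dualMap_eq_finrank_range,
    Fintype.range_linearCombination] at hle
  have hF := F.finrank_range_add_finrank_ker
  rw [Fintype.range_linearCombination, finrank_fintype_fun_eq_card] at hF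
  simp only [Set.finrank]
  omega

section Circuit

variable [DecidableEq ι] {x : ι → V} {S T F : Finset ι}

theorem exists_minimal_not_disjoint_span
    (h : ¬ Disjoint (span K (x '' S)) (span K (x '' F))) :
    ∃ T ⊆ F, ¬ Disjoint (span K (x '' S)) (span K (x '' T)) ∧
      ∀ t ∈ T, Disjoint (span K (x '' S)) (span K (x '' (T.erase t : Finset ι))) := by
  obtain ⟨T, hTF, hT⟩ := exists_minimal_le_of_wellFoundedLT
    (fun T : Finset ι => ¬ Disjoint (span K (x '' S)) (span K (x '' T))) F h
  exact ⟨T, hTF, hT.prop, fun t ht => not_not.1 (hT.not_prop_of_lt (Finset.erase_ssubset ht))⟩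

theorem linearIndepOn_of_minimal_not_disjoint
    (h : ¬ Disjoint (span K (x '' S)) (span K (x '' T)))
    (hmin : ∀ t ∈ T, Disjoint (span K (x '' S)) (span K (x '' (T.erase t : Finset ι)))) :
    LinearIndepOn K x T := by
  refine linearIndepOn_iff_notMem_span.2 fun t ht hmem => h ?_
  have hspan : span K (x '' T) = span K (x '' (T.erase t : Finset ι)) := by
    rw [← Finset.insert_erase ht, Finset.coe_insert, Set.image_insert_eq,
      span_insert_eq_span (by simpa using hmem), Finset.insert_erase ht]
  rw [hspan]
  exact hmin t ht

theorem card_add_finrank_le_of_minimal_not_disjoint [FiniteDimensional K V]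
    (h : ¬ Disjoint (span K (x '' S)) (span K (x '' T)))
    (hmin : ∀ t ∈ T, Disjoint (span K (x '' S)) (span K (x '' (T.erase t : Finset ι)))) :
    (x '' S).finrank K + T.card ≤ (x '' (S ∪ T)).finrank K + 1 := by
  obtain ⟨t, ht⟩ : T.Nonempty := Finset.nonempty_iff_ne_empty.2 fun h0 => h (by simp [h0])
  have hind := (linearIndepOn_of_minimal_not_disjoint h hmin).mono
    (Finset.coe_subset.2 (T.erase_subset t))
  have hmono : (x '' S ∪ x '' (T.erase t : Finset ι)).finrank K ≤ (x '' (S ∪ T)).finrank K := by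
    rw [← Set.image_union]
    exact Set.finrank_mono (Set.image_mono (Set.union_subset_union_right _ (T.erase_subset t)))
  rw [finrank_union_of_disjoint (hmin t ht), finrank_image_eq_card hind] at hmono
  have := Finset.card_erase_add_one ht
  omega

theorem coeff_ne_zero_of_minimal_not_disjoint
    (hmin : ∀ t ∈ T, Disjoint (span K (x '' S)) (span K (x '' (T.erase t : Finset ι))))
    {c : ι → K} (hc : ∑ a ∈ T, c a • x a ∈ span K (x '' S)) (hc0 : ∑ a ∈ T, c a • x a ≠ 0) :
    ∀ t ∈ T, c t ≠ 0 := by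
  intro t ht h0
  refine hc0 (disjoint_def.1 (hmin t ht) _ hc ?_)
  rw [← Finset.add_sum_erase _ _ ht, h0, zero_smul, zero_add]
  exact sum_mem fun a ha => smul_mem _ _ (subset_span ⟨a, ha, rfl⟩)

end Circuit

end Rank

section Splitting

open Module Submodule

variable {K ι V α : Type*} [Field K] [AddCommGroup V] [Module K V]

/-- The family of decomposable tensors `u a ⊗ v a`, where tensors of `K ^ α ⊗ V` are encoded as
functions `α → V`. Products of several factors are iterations of this one. -/
def productFamily (u : ι → α → K) (v : ι → V) : ι → α → V :=
  fun a i => u a i • v a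

/-- The family `x` splits on `F` if its span is the direct sum of the spans of two complementary
nonempty subfamilies. -/
def Splits (K : Type*) {ι V : Type*} [Field K] [AddCommGroup V] [Module K V] [DecidableEq ι]
    (x : ι → V) (F : Finset ι) : Prop :=
  ∃ S ⊆ F, S.Nonempty ∧ S ≠ F ∧ Disjoint (span K (x '' S)) (span K (x '' (F \ S : Finset ι)))

theorem apply_mem_span_of_mem_span_productFamily {u : ι → α → K} {v : ι → V} {S : Set ι}
    {s : α → V} (hs : s ∈ span K (productFamily u v '' S)) (i : α) : s i ∈ span K (v '' S) := by
  have hle : span K (productFamily u v '' S) ≤ (span K (v '' S)).comap (LinearMap.proj i) := by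
    rw [span_le]
    rintro _ ⟨a, ha, rfl⟩
    exact smul_mem _ _ (subset_span (Set.mem_image_of_mem v ha))
  exact hle hs

theorem disjoint_span_productFamily (u : ι → α → K) {v : ι → V} {S T : Set ι}
    (h : Disjoint (span K (v '' S)) (span K (v '' T))) :
    Disjoint (span K (productFamily u v '' S)) (span K (productFamily u v '' T)) :=
  disjoint_def.2 fun _ hS hT => funext fun i => disjoint_def.1 h _
    (apply_mem_span_of_mem_span_productFamily hS i) (apply_mem_span_of_mem_span_productFamily hT i)

theorem Splits.productFamily [DecidableEq ι] (u : ι → α → K) {v : ι → V} {F : Finset ι}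
    (h : Splits K v F) : Splits K (productFamily u v) F :=
  let ⟨S, hSF, hS, hne, hdisj⟩ := h
  ⟨S, hSF, hS, hne, disjoint_span_productFamily u hdisj⟩

theorem sum_dual_smul_mem_span_of_sum_productFamily_mem {u : ι → α → K} {v : ι → V} {S : Set ι}
    {T : Finset ι} {c : ι → K}
    (h : ∑ a ∈ T, c a • productFamily u v a ∈ span K (productFamily u v '' S)) (ψ : Dual K V) :
    ∑ a ∈ T, ψ (c a • v a) • u a ∈ span K (u '' S) := by
  have hψ (a : ι) : ψ.compLeft α (productFamily u v a) = ψ (v a) • u a := by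
    ext i
    simp [HHD.productFamily, mul_comm]
  have hle : span K (productFamily u v '' S) ≤ (span K (u '' S)).comap (ψ.compLeft α) := by
    rw [span_le]
    rintro _ ⟨a, ha, rfl⟩
    simpa only [SetLike.mem_coe, mem_comap, hψ] using
      smul_mem _ _ (subset_span (Set.mem_image_of_mem u ha))
  simpa only [mem_comap, map_sum, map_smul, hψ, smul_eq_mul, mul_smul] using hle h

theorem finrank_union_add_finrank_le_of_sum_productFamily_mem [Finite α] [FiniteDimensional K V]
    {u : ι → α → K} {v : ι → V} {S T : Finset ι} {c : ι → K} (hc : ∀ a ∈ T, c a ≠ 0)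
    (h : ∑ a ∈ T, c a • productFamily u v a ∈ span K (productFamily u v '' S)) :
    (u '' (S ∪ T)).finrank K + (v '' T).finrank K ≤ (u '' S).finrank K + T.card := by
  have hpair := finrank_range_add_finrank_range_le_card
    (u := fun a : T => (span K (u '' S)).mkQ (u a)) (w := fun a : T => c a • v a) fun ψ => by
      have := sum_dual_smul_mem_span_of_sum_productFamily_mem h ψ
      rw [← ker_mkQ (span K (u '' S)), LinearMap.mem_ker, map_sum, ← Finset.sum_coe_sort] at this
      simpa only [map_smul] using this
  have hu : Set.range (fun a : T => (span K (u '' S)).mkQ (u a)) =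
      (span K (u '' S)).mkQ '' (u '' T) := by
    rw [Set.image_image]
    ext
    simp
  have hv : (v '' T).finrank K ≤ (Set.range fun a : T => c a • v a).finrank K := by
    refine Submodule.finrank_mono (span_le.2 ?_)
    rintro _ ⟨a, ha, rfl⟩
    exact (smul_mem_iff _ (hc a ha)).1 (subset_span ⟨⟨a, ha⟩, rfl⟩)
  have hunion := finrank_mkQ_image_add_finrank (K := K) (u '' S) (u '' T)
  rw [hu, Fintype.card_coe] at hpair
  rw [Set.image_union]
  omega

theorem finrank_singleton_productFamily [Finite α] [FiniteDimensional K V]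
    (u : ι → α → K) (v : ι → V) (a : ι) :
    (u '' {a}).finrank K + (v '' {a}).finrank K ≤ (productFamily u v '' {a}).finrank K + 1 := by
  have hu := finrank_image_le_card (K := K) u {a}
  have hv := finrank_image_le_card (K := K) v {a}
  rw [Finset.coe_singleton, Finset.card_singleton] at hu hv
  by_cases hu0 : u a = 0
  · have : (u '' {a}).finrank K = 0 := by simp [Set.finrank, hu0]
    omega
  by_cases hv0 : v a = 0
  · have : (v '' {a}).finrank K = 0 := by simp [Set.finrank, hv0]
    omega
  obtain ⟨i, hi⟩ := Function.ne_iff.1 hu0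
  have huv : productFamily u v a ≠ 0 := fun h => smul_ne_zero hi hv0 (congrFun h i)
  have : (productFamily u v '' {a}).finrank K = 1 := by
    rw [Set.image_singleton, Set.finrank, finrank_span_singleton huv]
  omega

variable [Finite α] [FiniteDimensional K V]

theorem exists_finrank_union_le_of_not_disjoint {u : ι → α → K} {v : ι → V} {S F : Finset ι}
    (h : ¬ Disjoint (span K (productFamily u v '' S)) (span K (productFamily u v '' F))) :
    ∃ T ⊆ F, T.Nonempty ∧
      (u '' (S ∪ T)).finrank K + (v '' (S ∪ T)).finrank K + (productFamily u v '' S).finrank K ≤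
        (u '' S).finrank K + (v '' S).finrank K + (productFamily u v '' (S ∪ T)).finrank K := by
  classical
  obtain ⟨T, hTF, hT, hmin⟩ := exists_minimal_not_disjoint_span h
  obtain ⟨s, hsS, hsT, hs0⟩ : ∃ s ∈ span K (productFamily u v '' S),
      s ∈ span K (productFamily u v '' T) ∧ s ≠ 0 := by
    simpa [disjoint_def] using hT
  obtain ⟨c, rfl⟩ := (mem_span_image_finset_iff_exists_fun' K).1 hsT
  have hrank_u := finrank_union_add_finrank_le_of_sum_productFamily_mem
    (coeff_ne_zero_of_minimal_not_disjoint hmin hsS hs0) hsS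
  have hrank_v := finrank_union_lt_of_not_disjoint (mt (disjoint_span_productFamily u) hT)
  have hrank_uv := card_add_finrank_le_of_minimal_not_disjoint hT hmin
  refine ⟨T, hTF, Finset.nonempty_iff_ne_empty.2 fun h0 => hs0 (by simp [h0]), ?_⟩
  rw [← Set.image_union] at hrank_v
  omega

/-- A maximal subfamily for which the inequality holds cannot be enlarged, so its span is disjoint
from the span of its complement. -/
theorem finrank_add_finrank_le_of_not_splits [DecidableEq ι] {u : ι → α → K} {v : ι → V}
    {F : Finset ι} (hF : F.Nonempty) (h : ¬ Splits K (productFamily u v) F) :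
    (u '' F).finrank K + (v '' F).finrank K ≤ (productFamily u v '' F).finrank K + 1 := by
  let P (S : Finset ι) : Prop := S.Nonempty ∧
    (u '' S).finrank K + (v '' S).finrank K ≤ (productFamily u v '' S).finrank K + 1
  obtain ⟨a, ha⟩ := hF
  obtain ⟨S, ⟨hSF, hS, hrank⟩, hmax⟩ : ∃ S, (S ⊆ F ∧ P S) ∧ ∀ S', S' ⊆ F ∧ P S' → ¬ S ⊂ S' := by
    have hfin : {S | S ⊆ F ∧ P S}.Finite :=
      F.powerset.finite_toSet.subset fun S hS => by simpa using hS.1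
    obtain ⟨S, hS⟩ := hfin.exists_maximal ⟨{a}, by simpa using ha, by simp,
      by simpa using finrank_singleton_productFamily u v a⟩
    exact ⟨S, hS.prop, fun S' hS' => hS.not_gt hS'⟩
  obtain rfl | hne := eq_or_ne S F
  · exact hrank
  obtain ⟨T, hT, hT0, hle⟩ := exists_finrank_union_le_of_not_disjoint
    fun hdisj => h ⟨S, hSF, hS, hne, hdisj⟩
  rw [← Finset.coe_union] at hle
  refine (hmax (S ∪ T) ⟨Finset.union_subset hSF (hT.trans Finset.sdiff_subset),
    hS.mono Finset.subset_union_left, by omega⟩ ?_).elim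
  obtain ⟨t, ht⟩ := hT0
  exact Finset.ssubset_iff_of_subset Finset.subset_union_left |>.2
    ⟨t, Finset.mem_union_right _ ht, (Finset.mem_sdiff.1 (hT ht)).2⟩

end Splitting

section Kruskal

open Module Submodule

variable {K ι κ V X : Type*} [Field K] [AddCommGroup V] [Module K V]

/-- The Kruskal rank of the family `x` is at least `k`: any `k` of its members are linearly
independent. Families with fewer than `k` members qualify when they are linearly independent. -/
def HasKruskalRank (K : Type*) {ι V : Type*} [Field K] [AddCommGroup V] [Module K V] (k : ℕ)
    (x : ι → V) : Prop :=
  ∀ S : Finset ι, S.card ≤ k → LinearIndepOn K x S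

theorem HasKruskalRank.min_card_le_finrank [FiniteDimensional K V] {x : ι → V} {k : ℕ}
    (h : HasKruskalRank K k x) (S : Finset ι) : min k S.card ≤ (x '' S).finrank K := by
  obtain ⟨T, hTS, hT⟩ := Finset.exists_subset_card_eq (min_le_right k S.card)
  rw [← hT, ← finrank_image_eq_card (h T (hT.trans_le (min_le_left _ _)))]
  exact Set.finrank_mono (Set.image_mono (Finset.coe_subset.2 hTS))

theorem HasKruskalRank.min_card_toLeft_le_finrank [FiniteDimensional K V] {x : ι ⊕ κ → V} {k : ℕ}
    (h : HasKruskalRank K k (x ∘ Sum.inl)) (F : Finset (ι ⊕ κ)) :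
    min k F.toLeft.card ≤ (x '' F).finrank K := by
  refine (h.min_card_le_finrank F.toLeft).trans (Set.finrank_mono ?_)
  rintro _ ⟨a, ha, rfl⟩
  exact ⟨Sum.inl a, by simpa using ha, rfl⟩

section ZeroSum

variable {z : κ → V} {F : Finset κ}

theorem finrank_lt_card_of_sum_eq_zero (hF : F.Nonempty) (h : ∑ a ∈ F, z a = 0) :
    (z '' F).finrank K < F.card := by
  refine (finrank_image_le_card z F).lt_of_ne fun hcard => ?_
  have hind : LinearIndepOn K z F := by
    rw [LinearIndepOn, linearIndependent_iff_card_eq_finrank_span, ← Set.image_eq_range, hcard]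
    exact Fintype.card_coe F
  obtain ⟨a, ha⟩ := hF
  exact one_ne_zero (linearIndepOn_finset_iff.1 hind (fun _ => (1 : K)) (by simpa using h) a ha)

variable [DecidableEq κ]

theorem zero_sum_induction {motive : Finset κ → Prop} (empty : motive ∅)
    (minimal : ∀ F : Finset κ, F.Nonempty → ∑ a ∈ F, z a = 0 →
      (∀ S ⊆ F, S.Nonempty → S ≠ F → ∑ a ∈ S, z a ≠ 0) → motive F)
    (union : ∀ S T : Finset κ, Disjoint S T → motive S → motive T →
      motive (S ∪ T))
    (hF : ∑ a ∈ F, z a = 0) : motive F := by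
  induction F using Finset.strongInduction with
  | H F ih =>
    obtain rfl | hne := F.eq_empty_or_nonempty
    · exact empty
    by_cases hmin : ∀ S ⊆ F, S.Nonempty → S ≠ F → ∑ a ∈ S, z a ≠ 0
    · exact minimal F hne hF hmin
    push Not at hmin
    obtain ⟨S, hSF, hS, hSne, hS0⟩ := hmin
    have hdiff : ∑ a ∈ F \ S, z a = 0 := by
      rwa [← Finset.sum_sdiff hSF, hS0, add_zero] at hF
    rw [← Finset.union_sdiff_of_subset hSF]
    exact union _ _ Finset.disjoint_sdiff (ih S (hSF.ssubset_of_ne hSne) hS0)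
      (ih _ (Finset.sdiff_ssubset hSF hS) hdiff)

theorem not_splits_of_minimal_zero_sum (h : ∑ a ∈ F, z a = 0)
    (hmin : ∀ S ⊆ F, S.Nonempty → S ≠ F → ∑ a ∈ S, z a ≠ 0) : ¬ Splits K z F := by
  rintro ⟨S, hSF, hS, hne, hdisj⟩
  have hsum (T : Finset κ) : ∑ a ∈ T, z a ∈ span K (z '' T) :=
    sum_mem fun a ha => subset_span ⟨a, ha, rfl⟩
  refine hmin S hSF hS hne (disjoint_def.1 hdisj _ (hsum S) ?_)
  rw [← Finset.sum_sdiff hSF] at h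
  rw [eq_neg_of_add_eq_zero_right h]
  exact neg_mem (hsum _)

end ZeroSum

theorem exists_perm_eq_comp_of_map_univ_eq [Fintype ι] {f g : ι → X}
    (h : Finset.univ.val.map f = Finset.univ.val.map g) : ∃ σ : Equiv.Perm ι, g = f ∘ σ := by
  classical
  have hfiber (c : X) : Fintype.card {a // g a = c} = Fintype.card {a // f a = c} := by
    have hcount := congrArg (Multiset.count c) h
    simp only [Multiset.count_map, eq_comm (a := c)] at hcount
    rw [Fintype.card_subtype, Fintype.card_subtype]
    exact hcount.symm
  let σ : Equiv.Perm ι :=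
    Equiv.ofFiberEquiv (f := g) (g := f) fun c => Fintype.equivOfCardEq (hfiber c)
  exact ⟨σ, funext fun a => (Equiv.ofFiberEquiv_map (f := g) (g := f) _ a).symm⟩

theorem map_toLeft_val_union [DecidableEq ι] (f : ι → X) {S T : Finset (ι ⊕ ι)}
    (h : Disjoint S T) : (S ∪ T).toLeft.val.map f = S.toLeft.val.map f + T.toLeft.val.map f := by
  rw [Finset.toLeft_union, ← Finset.disjUnion_eq_union, Finset.disjUnion_val, Multiset.map_add]
  rw [Finset.disjoint_left] at h ⊢
  simpa using fun a => @h (Sum.inl a)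

theorem map_toRight_val_union [DecidableEq ι] (f : ι → X) {S T : Finset (ι ⊕ ι)}
    (h : Disjoint S T) : (S ∪ T).toRight.val.map f = S.toRight.val.map f + T.toRight.val.map f := by
  rw [Finset.toRight_union, ← Finset.disjUnion_eq_union, Finset.disjUnion_val, Multiset.map_add]
  rw [Finset.disjoint_left] at h ⊢
  simpa using fun a => @h (Sum.inr a)

variable {α β : Type*} [Finite α] [Finite β]

theorem finrank_add_finrank_add_finrank_le_of_not_splits [DecidableEq ι] [FiniteDimensional K V]
    {u : ι → α → K} {v : ι → β → K} {w : ι → V} {F : Finset ι} (hF : F.Nonempty)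
    (h : ¬ Splits K (productFamily u (productFamily v w)) F) :
    (u '' F).finrank K + (v '' F).finrank K + (w '' F).finrank K ≤
      (productFamily u (productFamily v w) '' F).finrank K + 2 := by
  have huvw := finrank_add_finrank_le_of_not_splits hF h
  have hvw := finrank_add_finrank_le_of_not_splits hF (mt (Splits.productFamily u) h)
  omega

variable [Fintype ι] [FiniteDimensional K V] {k₁ k₂ k₃ : ℕ}

theorem card_toLeft_le_one_of_minimal_zero_sum
    {u : ι ⊕ ι → α → K} {v : ι ⊕ ι → β → K} {w : ι ⊕ ι → V}
    (hu : HasKruskalRank K k₁ (u ∘ Sum.inl)) (hv : HasKruskalRank K k₂ (v ∘ Sum.inl))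
    (hw : HasKruskalRank K k₃ (w ∘ Sum.inl))
    (hk : 2 ≤ Fintype.card ι → 2 * Fintype.card ι + 2 ≤
      min (Fintype.card ι) k₁ + min (Fintype.card ι) k₂ + min (Fintype.card ι) k₃)
    {F : Finset (ι ⊕ ι)} (hF : F.Nonempty)
    (hsum : ∑ a ∈ F, productFamily u (productFamily v w) a = 0)
    (hmin : ∀ S ⊆ F, S.Nonempty → S ≠ F → ∑ a ∈ S, productFamily u (productFamily v w) a ≠ 0)
    (hle : F.toRight.card ≤ F.toLeft.card) : F.toLeft.card ≤ 1 := by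
  classical
  by_contra! hcard
  have hrank := finrank_add_finrank_add_finrank_le_of_not_splits hF
    (not_splits_of_minimal_zero_sum (K := K) hsum hmin)
  have hlt := finrank_lt_card_of_sum_eq_zero (K := K) hF hsum
  have hu' := hu.min_card_toLeft_le_finrank F
  have hv' := hv.min_card_toLeft_le_finrank F
  have hw' := hw.min_card_toLeft_le_finrank F
  have hF_card := F.card_toLeft_add_card_toRight
  have hN : F.toLeft.card ≤ Fintype.card ι := Finset.card_le_univ _
  have hk' := hk (hcard.trans_le hN)
  omega

/-- Cancelling minimal zero-sum subfamilies: each of them either has more members on the right than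
on the left, or consists of one member on each side. -/
theorem card_toLeft_le_card_toRight_of_zero_sum
    {u : ι ⊕ ι → α → K} {v : ι ⊕ ι → β → K} {w : ι ⊕ ι → V}
    (hne : ∀ a, productFamily u (productFamily v w) (Sum.inl a) ≠ 0)
    (hu : HasKruskalRank K k₁ (u ∘ Sum.inl)) (hv : HasKruskalRank K k₂ (v ∘ Sum.inl))
    (hw : HasKruskalRank K k₃ (w ∘ Sum.inl))
    (hk : 2 ≤ Fintype.card ι → 2 * Fintype.card ι + 2 ≤
      min (Fintype.card ι) k₁ + min (Fintype.card ι) k₂ + min (Fintype.card ι) k₃)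
    {F : Finset (ι ⊕ ι)} (hsum : ∑ a ∈ F, productFamily u (productFamily v w) a = 0) :
    F.toLeft.card ≤ F.toRight.card ∧ (F.toLeft.card = F.toRight.card →
      F.toLeft.val.map (productFamily u (productFamily v w) ∘ Sum.inl) =
        F.toRight.val.map (-productFamily u (productFamily v w) ∘ Sum.inr)) := by
  classical
  set z := productFamily u (productFamily v w)
  let Cancels (F : Finset (ι ⊕ ι)) : Prop := F.toLeft.card ≤ F.toRight.card ∧
    (F.toLeft.card = F.toRight.card →
      F.toLeft.val.map (z ∘ Sum.inl) = F.toRight.val.map (-z ∘ Sum.inr))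
  refine zero_sum_induction (motive := Cancels) ⟨le_rfl, fun _ => rfl⟩ ?_ ?_ hsum
  · intro F hF hsum hmin
    obtain hlt | hle := lt_or_ge F.toLeft.card F.toRight.card
    · exact ⟨hlt.le, fun heq => absurd heq hlt.ne⟩
    have hleft := card_toLeft_le_one_of_minimal_zero_sum hu hv hw hk hF hsum hmin hle
    have hpos := Finset.card_pos.2 hF
    have hcard := F.card_toLeft_add_card_toRight
    obtain ⟨a, ha⟩ := Finset.card_eq_one.1 (show F.toLeft.card = 1 by omega)
    rw [← F.toLeft_disjSum_toRight, Finset.sum_disjSum, ha, Finset.sum_singleton] at hsum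
    obtain hright | hright : F.toRight.card = 0 ∨ F.toRight.card = 1 := by omega
    · rw [Finset.card_eq_zero.1 hright, Finset.sum_empty, add_zero] at hsum
      exact absurd hsum (hne a)
    · obtain ⟨b, hb⟩ := Finset.card_eq_one.1 hright
      rw [hb, Finset.sum_singleton] at hsum
      simpa [Cancels, ha, hb] using eq_neg_of_add_eq_zero_left hsum
  · rintro S T hdisj ⟨hS, hS_eq⟩ ⟨hT, hT_eq⟩
    have hleft := map_toLeft_val_union (z ∘ Sum.inl) hdisj
    have hright := map_toRight_val_union (-z ∘ Sum.inr) hdisj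
    have hcard_left := congrArg Multiset.card hleft
    have hcard_right := congrArg Multiset.card hright
    simp only [Multiset.card_add, Multiset.card_map, Finset.card_val] at hcard_left hcard_right
    refine ⟨by omega, fun heq => ?_⟩
    rw [hleft, hright, hS_eq (by omega), hT_eq (by omega)]

/-- **Kruskal's theorem**, by the splitting argument of Lovitz and Petrov: a zero-sum family without
proper zero-sum subfamilies does not split, which bounds the ranks of its three factors from above,
while the Kruskal ranks bound them from below. -/
theorem exists_perm_of_sum_productFamily_eq {u u' : ι → α → K} {v v' : ι → β → K} {w w' : ι → V}
    (hne : ∀ a, productFamily u (productFamily v w) a ≠ 0)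
    (hu : HasKruskalRank K k₁ u) (hv : HasKruskalRank K k₂ v) (hw : HasKruskalRank K k₃ w)
    (hk : 2 ≤ Fintype.card ι → 2 * Fintype.card ι + 2 ≤
      min (Fintype.card ι) k₁ + min (Fintype.card ι) k₂ + min (Fintype.card ι) k₃)
    (hsum : ∑ a, productFamily u (productFamily v w) a =
      ∑ a, productFamily u' (productFamily v' w') a) :
    ∃ σ : Equiv.Perm ι, productFamily u' (productFamily v' w') =
      productFamily u (productFamily v w) ∘ σ := by
  classical
  let U := Sum.elim u (-u')
  let Q := Sum.elim v v'
  let W := Sum.elim w w'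
  have hright : -productFamily U (productFamily Q W) ∘ Sum.inr =
      productFamily u' (productFamily v' w') := by
    ext a i
    simp [U, Q, W, productFamily]
  have hzero : ∑ a, productFamily U (productFamily Q W) a = 0 := by
    have hinl (a : ι) : productFamily U (productFamily Q W) (Sum.inl a) =
      productFamily u (productFamily v w) a := rfl
    simp only [Fintype.sum_sum_type, hinl, hsum, ← hright, Function.comp_apply, Pi.neg_apply,
      Finset.sum_neg_distrib, neg_add_cancel]
  have hcount := card_toLeft_le_card_toRight_of_zero_sum
    (u := U) (v := Q) (w := W) hne hu hv hw hk hzero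
  have hleft_univ : (Finset.univ : Finset (ι ⊕ ι)).toLeft = Finset.univ := by ext; simp
  have hright_univ : (Finset.univ : Finset (ι ⊕ ι)).toRight = Finset.univ := by ext; simp
  rw [hleft_univ, hright_univ, hright] at hcount
  exact exists_perm_eq_comp_of_map_univ_eq (hcount.2 rfl)

end Kruskal

section GenericLifting

theorem exists_isOpen_inter_closure_subset_or_subset_compl {X : Type*} [TopologicalSpace X]
    {C : Set X} (hC : Topology.IsConstructible C) (η : X) :
    ∃ U, IsOpen U ∧ η ∈ U ∧ (U ∩ closure {η} ⊆ C ∨ U ∩ closure {η} ⊆ Cᶜ) := by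
  induction hC using Topology.IsConstructible.empty_union_induction with
  | open_retrocompact U hU _ =>
    by_cases hη : η ∈ U
    · exact ⟨U, hU, hη, Or.inl Set.inter_subset_left⟩
    · refine ⟨Set.univ, isOpen_univ, trivial, Or.inr fun x hx hxU => ?_⟩
      obtain ⟨_, hyU, rfl⟩ := mem_closure_iff.1 hx.2 U hU hxU
      exact hη hyU
  | union s _ t _ ihs iht =>
    obtain ⟨U, hU, hηU, hUs⟩ := ihs
    obtain ⟨V, hV, hηV, hVt⟩ := iht
    refine ⟨U ∩ V, hU.inter hV, ⟨hηU, hηV⟩, ?_⟩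
    rcases hUs with hUs | hUs
    · exact Or.inl fun x hx => Or.inl (hUs ⟨hx.1.1, hx.2⟩)
    rcases hVt with hVt | hVt
    · exact Or.inl fun x hx => Or.inr (hVt ⟨hx.1.2, hx.2⟩)
    · exact Or.inr fun x hx hst => hst.elim (hUs ⟨hx.1.1, hx.2⟩) (hVt ⟨hx.1.2, hx.2⟩)
  | compl s _ ih =>
    obtain ⟨U, hU, hηU, h⟩ := ih
    exact ⟨U, hU, hηU, by rwa [compl_compl, or_comm]⟩

variable {K : Type*} [Field K]

theorem nonempty_algHom_of_finiteType (K : Type*) [Field K] (A L : Type*) [CommRing A]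
    [Nontrivial A] [Algebra K A] [Algebra.FiniteType K A] [Field L] [Algebra K L]
    [IsAlgClosed L] : Nonempty (A →ₐ[K] L) := by
  obtain ⟨M, hM⟩ := Ideal.exists_maximal A
  let _ : Field (A ⧸ M) := Ideal.Quotient.field M
  have : Module.Finite K (A ⧸ M) := finite_of_finite_type_of_isJacobsonRing K (A ⧸ M)
  exact ⟨(IsAlgClosed.lift (R := K) (S := A ⧸ M)).comp (Ideal.Quotient.mkₐ K M)⟩

/-- By Chevalley's theorem, the image of `Spec B` contains a nonempty open subset of its closure. -/
theorem exists_forall_exists_algHom_comp_eq {A B : Type*} [CommRing A] [IsNoetherianRing A]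
    [Algebra K A] [CommRing B] [IsDomain B] [Algebra K B] [Algebra.FiniteType K B]
    (φ : A →ₐ[K] B) :
    ∃ a, φ a ≠ 0 ∧ ∀ y : A →ₐ[K] K, RingHom.ker φ ≤ RingHom.ker y → y a ≠ 0 →
      ∀ (L : Type*) [Field L] [Algebra K L] [IsAlgClosed L],
        ∃ x : B →ₐ[K] L, ∀ p, x (φ p) = algebraMap K L (y p) := by
  have hφ : φ.toRingHom.FinitePresentation := by
    refine RingHom.FinitePresentation.of_finiteType.1 ?_
    refine RingHom.FiniteType.of_comp_finiteType (f := algebraMap K A) ?_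
    rw [AlgHom.toRingHom_eq_coe, φ.comp_algebraMap]
    exact RingHom.finiteType_algebraMap.2 inferInstance
  let η : PrimeSpectrum A := PrimeSpectrum.comap φ.toRingHom ⊥
  obtain ⟨U, hU, hηU, himage⟩ := exists_isOpen_inter_closure_subset_or_subset_compl
    (PrimeSpectrum.isConstructible_range_comap hφ) η
  replace himage := himage.resolve_right fun h => h ⟨hηU, subset_closure rfl⟩ ⟨⊥, rfl⟩
  obtain ⟨_, ⟨a, rfl⟩, hηa, haU⟩ :=
    PrimeSpectrum.isTopologicalBasis_basic_opens.exists_subset_of_mem_open hηU hU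
  refine ⟨a, hηa, fun y hy hya L _ _ _ => ?_⟩
  let m : PrimeSpectrum A := ⟨RingHom.ker y, RingHom.ker_isPrime y⟩
  obtain ⟨q, hq⟩ := himage (a := m) ⟨haU hya, (PrimeSpectrum.le_iff_mem_closure η m).1 hy⟩
  obtain ⟨ψ⟩ := nonempty_algHom_of_finiteType K (B ⧸ q.asIdeal) L
  refine ⟨ψ.comp (Ideal.Quotient.mkₐ K q.asIdeal), fun p => ?_⟩
  have hp : φ (p - algebraMap K A (y p)) ∈ q.asIdeal := by
    have : p - algebraMap K A (y p) ∈ m.asIdeal := by simp [m, RingHom.mem_ker]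
    rwa [← hq] at this
  rw [map_sub, AlgHom.commutes, ← Ideal.Quotient.eq] at hp
  exact (congrArg ψ hp).trans (ψ.commutes (y p))

open MvPolynomial in
theorem exists_forall_mem_zeroLocus_exists_lift {σ τ : Type*} [Finite σ] [Finite τ]
    (φ : τ → MvPolynomial σ K) {g : MvPolynomial σ K} (hg : g ≠ 0) :
    ∃ f : MvPolynomial τ K, aeval φ f ≠ 0 ∧
      ∀ y ∈ zeroLocus K (RingHom.ker (aeval φ : MvPolynomial τ K →ₐ[K] MvPolynomial σ K)),
        aeval y f ≠ 0 → ∀ (L : Type*) [Field L] [Algebra K L] [IsAlgClosed L],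
          ∃ x : σ → L, aeval x g ≠ 0 ∧ ∀ j, aeval x (φ j) = algebraMap K L (y j) := by
  have hpowers := Submonoid.powers_le.2 (mem_nonZeroDivisors_of_ne_zero hg)
  let B := Localization.Away g
  have : IsDomain B := IsLocalization.isDomain_localization hpowers
  have : Algebra.FiniteType K B :=
    Algebra.FiniteType.trans (S := MvPolynomial σ K) inferInstance
      (IsLocalization.finiteType_of_monoid_fg (Submonoid.powers g) B)
  let ι : MvPolynomial σ K →ₐ[K] B := Algebra.algHom K (MvPolynomial σ K) B
  have hι : Function.Injective ι := IsLocalization.injective B hpowers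
  obtain ⟨f, hf, hlift⟩ := exists_forall_exists_algHom_comp_eq (ι.comp (aeval φ))
  refine ⟨f, fun h => hf ((congrArg ι h).trans ι.map_zero), fun y hy hyf L _ _ _ => ?_⟩
  obtain ⟨χ, hχ⟩ := hlift (aeval y) (fun p hp => hy p (hι (hp.trans ι.map_zero.symm))) hyf L
  have haeval (p : MvPolynomial σ K) : aeval (χ ∘ ι ∘ X) p = χ (ι p) := by
    rw [← AlgHom.comp_apply, aeval_unique (χ.comp ι)]
    rfl
  refine ⟨χ ∘ ι ∘ X, ?_, fun j => ?_⟩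
  · rw [haeval]
    exact ((IsLocalization.Away.algebraMap_isUnit g).map χ).ne_zero
  · simpa [haeval] using hχ (X j)

end GenericLifting

section Grid

open Function

variable {κ : Type*} {α : κ → Type*} {β : Type*}

/-- In each direction, the pairs of coordinates of `i, j` and of `i', j'` agree up to order.
Products of pairs of terms in the expansion of a product of sums coincide for this reason. -/
def SamePairs (i j i' j' : ∀ k, α k) : Prop :=
  ∀ k, s(i k, j k) = s(i' k, j' k)

theorem dependsOn_of_forall_update [Finite κ] [DecidableEq κ] {f : (∀ k, α k) → β} {s : Set κ}
    (h : ∀ k ∉ s, ∀ i a, f (update i k a) = f i) : DependsOn f s := by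
  have := Fintype.ofFinite κ
  intro i j hij
  have hpiecewise (t : Finset κ) : f (t.piecewise j i) = f i := by
    induction t using Finset.induction_on with
    | empty => simp
    | insert k t hkt ih =>
      rw [Finset.piecewise_insert]
      by_cases hk : k ∈ s
      · rwa [← hij k hk, ← Finset.piecewise_eq_of_notMem t j i hkt, update_eq_self]
      · rw [h k hk, ih]
  simpa using (hpiecewise Finset.univ).symm

theorem update_eq_of_map_samePairs [DecidableEq κ] {f : (∀ k, α k) → β}
    (hf : ∀ i j i' j', SamePairs i j i' j' → s(f i, f j) = s(f i', f j'))
    {k : κ} {i : ∀ k, α k} {a : α k} (hne : f (update i k a) ≠ f i) (j : ∀ k, α k) :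
    f (update j k (i k)) = f i ∧ f (update j k a) = f (update i k a) := by
  have hpairs : SamePairs i (update j k a) (update i k a) (update j k (i k)) := fun l => by
    by_cases hl : l = k
    · subst hl
      simp [Sym2.eq_swap]
    · simp [hl]
  rcases Sym2.eq_iff.1 (hf _ _ _ _ hpairs) with h | h
  · exact absurd h.1.symm hne
  · exact ⟨h.1.symm, h.2⟩

theorem exists_dependsOn_singleton_of_map_samePairs [Finite κ] [Nonempty κ] {f : (∀ k, α k) → β}
    (hf : ∀ i j i' j', SamePairs i j i' j' → s(f i, f j) = s(f i', f j')) :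
    ∃ k, DependsOn f {k} := by
  classical
  by_cases hconst : ∀ k i a, f (update i k a) = f i
  · exact ⟨Classical.arbitrary κ, dependsOn_of_forall_update fun k _ => hconst k⟩
  push Not at hconst
  obtain ⟨k, i, a, hne⟩ := hconst
  refine ⟨k, dependsOn_of_forall_update fun l hl i' b => by_contra fun hne' => hne ?_⟩
  have hk := fun j => update_eq_of_map_samePairs hf hne j
  have hl' := fun j => update_eq_of_map_samePairs hf hne' j
  -- If both directions mattered, `f` would not see `l` once `k` is set, nor `k` once `l` is set.
  have hcomm (x : α k) (y : α l) : update (update i l y) k x = update (update i k x) l y :=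
    (update_comm (Ne.symm hl) x y i).symm
  rw [← (hk (update i l (i' l))).2, hcomm, (hl' _).1, ← (hl' (update i k (i k))).1, ← hcomm,
    (hk _).1]

theorem exists_eq_piCongr_of_dependsOn [Finite κ] [∀ k, Nontrivial (α k)]
    (τ : Equiv.Perm (∀ k, α k)) (hτ : ∀ l, ∃ k, DependsOn (fun i => τ i l) {k}) :
    ∃ (ψ : Equiv.Perm κ) (π : ∀ k, α k ≃ α (ψ k)), τ = ψ.piCongr π := by
  classical
  choose c hc using hτ
  simp only [DependsOn, Set.mem_singleton_iff, forall_eq] at hc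
  obtain ⟨i₀⟩ : Nonempty (∀ k, α k) := inferInstance
  have hc_surj : Surjective c := fun k => by
    by_contra! hk
    obtain ⟨a, ha⟩ := exists_ne (i₀ k)
    have : τ (update i₀ k a) = τ i₀ := funext fun l => hc l (update_of_ne (hk l) _ _)
    exact ha (by simpa using congrFun (τ.injective this) k)
  let ψ : Equiv.Perm κ := (Equiv.ofBijective c (Finite.surjective_iff_bijective.1 hc_surj)).symm
  have hψ (k : κ) : c (ψ k) = k := ψ.symm_apply_apply k
  have hψ_dep {k : κ} {i j : ∀ k, α k} (h : i k = j k) : τ i (ψ k) = τ j (ψ k) :=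
    hc (ψ k) (by rwa [hψ])
  have hbij (k : κ) : Bijective fun a => τ (update i₀ k a) (ψ k) := by
    refine ⟨fun a b hab => ?_, fun b => ⟨τ.symm (update i₀ (ψ k) b) k, ?_⟩⟩
    · have : τ (update i₀ k a) = τ (update i₀ k b) := funext fun l => by
        by_cases hl : c l = k
        · obtain rfl : ψ k = l := ψ.eq_symm_apply.1 hl.symm
          exact hab
        · exact hc l (by simp [hl])
      simpa using congrFun (τ.injective this) k
    · exact (hψ_dep (j := τ.symm (update i₀ (ψ k) b)) (by simp)).trans (by simp)
  refine ⟨ψ, fun k => Equiv.ofBijective _ (hbij k), Equiv.ext fun i => funext fun l => ?_⟩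
  obtain ⟨k, rfl⟩ := ψ.surjective l
  rw [Equiv.piCongr_apply_apply]
  exact hψ_dep (by simp)

theorem exists_eq_piCongr_of_map_samePairs [Finite κ] [∀ k, Nontrivial (α k)]
    (τ : Equiv.Perm (∀ k, α k))
    (hτ : ∀ i j i' j', SamePairs i j i' j' → SamePairs (τ i) (τ j) (τ i') (τ j')) :
    ∃ (ψ : Equiv.Perm κ) (π : ∀ k, α k ≃ α (ψ k)), τ = ψ.piCongr π :=
  exists_eq_piCongr_of_dependsOn τ fun l =>
    have : Nonempty κ := ⟨l⟩
    exists_dependsOn_singleton_of_map_samePairs fun i j i' j' h => hτ i j i' j' h l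

end Grid

section SegreStar

variable {K : Type*} [Field K] {d m : ℕ} {n : Fin d → ℕ}

theorem outer_mul (a b : ∀ x : Fin d, Fin (n x) → K) : outer (a * b) = outer a * outer b :=
  funext fun _ => Finset.prod_mul_distrib

theorem outer_inv (a : ∀ x : Fin d, Fin (n x) → K) : outer a⁻¹ = (outer a)⁻¹ :=
  funext fun _ => Finset.prod_inv_distrib _

theorem mul_mem_segreStar {A B : Tensor K n} (hA : A ∈ segreStar K n) (hB : B ∈ segreStar K n) :
    A * B ∈ segreStar K n := by
  obtain ⟨⟨hA0, a, rfl⟩, hA⟩ := hA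
  obtain ⟨⟨-, b, rfl⟩, hB⟩ := hB
  obtain ⟨j, -⟩ := Function.ne_iff.1 hA0
  have hne (j) : (outer a * outer b) j ≠ 0 := mul_ne_zero (hA j) (hB j)
  exact ⟨⟨fun h => hne j (congrFun h j), a * b, (outer_mul a b).symm⟩, hne⟩

theorem inv_mem_segreStar {A : Tensor K n} (hA : A ∈ segreStar K n) : A⁻¹ ∈ segreStar K n := by
  obtain ⟨⟨hA0, a, rfl⟩, hA⟩ := hA
  obtain ⟨j, -⟩ := Function.ne_iff.1 hA0
  have hne (j) : (outer a)⁻¹ j ≠ 0 := inv_ne_zero (hA j)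
  exact ⟨⟨fun h => hne j (congrFun h j), a⁻¹, (outer_inv a).symm⟩, hne⟩

theorem mul_inv_cancel_of_mem_segreStar {A : Tensor K n} (hA : A ∈ segreStar K n) : A * A⁻¹ = 1 :=
  funext fun j => mul_inv_cancel₀ (hA.2 j)

end SegreStar

section Orbit

variable {K : Type*} {d m : ℕ} {n : Fin d → ℕ} {r : Fin m → ℕ}

theorem Family.toUnordered_eq_iff {A B : Family K n r} :
    A.toUnordered = B.toUnordered ↔ ∃ (ψ : Equiv.Perm (Fin m))
      (π : ∀ k, Fin (r k) ≃ Fin (r (ψ k))), ∀ k i, B k i = A (ψ k) (π k i) :=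
  Quotient.eq

variable [Field K]

theorem IsHHD.of_toUnordered_eq {A B : Family K n r} {T : Tensor K n} (hA : IsHHD A T)
    (h : A.toUnordered = B.toUnordered) : IsHHD B T := by
  obtain ⟨ψ, π, hAB⟩ := Family.toUnordered_eq_iff.1 h
  refine ⟨fun k i => hAB k i ▸ hA.1 _ _, hA.2.trans ?_⟩
  simp only [hAB, Equiv.sum_comp (π _) (A (ψ _)), Equiv.prod_comp ψ fun k => ∑ i, A k i]

theorem starOrbit_smul_subset {D : Fin m → Tensor K n} (hD : ∀ k, D k ∈ segreStar K n)
    (hD_prod : ∏ k, D k = 1) (A : Family K n r) :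
    starOrbit (Family.toUnordered fun k i => D k * A k i) ⊆ starOrbit A.toUnordered := by
  rintro _ ⟨C, E, hC, hE, hE_prod, rfl⟩
  obtain ⟨ψ, π, hAC⟩ := Family.toUnordered_eq_iff.1 hC.symm
  refine ⟨fun k i => A (ψ k) (π k i), fun k => E k * D (ψ k),
    (Family.toUnordered_eq_iff.2 ⟨ψ, π, fun _ _ => rfl⟩).symm,
    fun k => mul_mem_segreStar (hE k) (hD _), ?_, ?_⟩
  · rw [Finset.prod_mul_distrib, hE_prod, Equiv.prod_comp ψ D, hD_prod, one_mul]
  · simp only [hAC, mul_assoc]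

theorem starOrbit_smul {D : Fin m → Tensor K n} (hD : ∀ k, D k ∈ segreStar K n)
    (hD_prod : ∏ k, D k = 1) (A : Family K n r) :
    starOrbit (Family.toUnordered fun k i => D k * A k i) = starOrbit A.toUnordered := by
  refine (starOrbit_smul_subset hD hD_prod A).antisymm ?_
  have hinv : ∏ k, (D k)⁻¹ = 1 := by rw [Finset.prod_inv_distrib, hD_prod, inv_one]
  have hcancel (k : Fin m) (B : Tensor K n) : (D k)⁻¹ * (D k * B) = B := by
    rw [← mul_assoc, mul_comm _ (D k), mul_inv_cancel_of_mem_segreStar (hD k), one_mul]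
  simpa only [hcancel] using
    starOrbit_smul_subset (fun k => inv_mem_segreStar (hD k)) hinv fun k i => D k * A k i

end Orbit

section Expansion

variable {K L : Type*} [Field K] [Field L] {d m : ℕ} {n : Fin d → ℕ} {r : Fin m → ℕ}

/-- The terms obtained by multiplying out the Hadamard product of the sums `∑ i, A k i`. -/
def Family.expansion (A : Family K n r) (i : ∀ k, Fin (r k)) : Tensor K n :=
  ∏ k, A k (i k)

theorem Family.sum_expansion (A : Family K n r) : ∑ i, A.expansion i = ∏ k, ∑ i, A k i := by
  rw [Finset.prod_univ_sum, Fintype.piFinset_univ]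
  rfl

theorem Family.expansion_mul_expansion_of_samePairs (A : Family K n r)
    {i j i' j' : ∀ k, Fin (r k)} (h : SamePairs i j i' j') :
    A.expansion i * A.expansion j = A.expansion i' * A.expansion j' := by
  simp only [Family.expansion, ← Finset.prod_mul_distrib]
  refine Finset.prod_congr rfl fun k _ => ?_
  rcases Sym2.eq_iff.1 (h k) with ⟨hi, hj⟩ | ⟨hi, hj⟩
  · rw [hi, hj]
  · rw [hi, hj, mul_comm]

theorem Family.exists_toUnordered_eq_and_expansion_comp_piCongr (A : Family K n r)
    (ψ : Equiv.Perm (Fin m)) (π : ∀ k, Fin (r k) ≃ Fin (r (ψ k))) :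
    ∃ B : Family K n r, A.toUnordered = B.toUnordered ∧
      B.expansion ∘ ψ.piCongr π = A.expansion := by
  let B : Family K n r := ψ.piCongr (fun k => (π k).arrowCongr (Equiv.refl _)) A
  have hB (k : Fin m) (i : Fin (r k)) : B (ψ k) (π k i) = A k i := by
    simp [B, Equiv.piCongr_apply_apply]
  refine ⟨B, (Family.toUnordered_eq_iff.2 ⟨ψ, π, fun k i => (hB k i).symm⟩).symm,
    funext fun i => ?_⟩
  simp only [Function.comp_apply, Family.expansion, ← hB]
  rw [← Equiv.prod_comp ψ]
  simp only [Equiv.piCongr_apply_apply]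

theorem Family.apply_ne_zero_of_expansion_ne_zero [∀ k, Nonempty (Fin (r k))] {A : Family K n r}
    {j : ∀ x, Fin (n x)} (h : ∀ i, A.expansion i j ≠ 0) (k : Fin m) (a : Fin (r k)) :
    A k a j ≠ 0 := by
  obtain ⟨i, rfl⟩ := Function.surjective_eval (β := fun k => Fin (r k)) k a
  specialize h i
  rw [Family.expansion, Finset.prod_apply] at h
  exact Finset.prod_ne_zero_iff.1 h k (Finset.mem_univ k)

theorem apply_eq_apply_of_forall_prod_eq_one {M κ : Type*} [CommMonoid M] [Fintype κ]
    {α : κ → Type*} [∀ k, Nonempty (α k)] {q : ∀ k, α k → M}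
    (h : ∀ i : ∀ k, α k, ∏ k, q k (i k) = 1) (k : κ) (a b : α k) : q k a = q k b := by
  classical
  obtain ⟨i⟩ : Nonempty (∀ k, α k) := inferInstance
  have hsplit (c : α k) : q k c * ∏ l ∈ Finset.univ.erase k, q l (i l) = 1 := by
    rw [← h (Function.update i k c), ← Finset.mul_prod_erase _ _ (Finset.mem_univ k),
      Function.update_self]
    congr 1
    exact Finset.prod_congr rfl fun l hl => by
      rw [Function.update_of_ne (Finset.ne_of_mem_erase hl)]
  exact left_inv_eq_right_inv (hsplit a) (mul_comm _ (q k b) ▸ hsplit b)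

theorem starOrbit_eq_of_expansion_eq [∀ k, Nonempty (Fin (r k))] {A B : Family K n r}
    (hA : ∀ k i, A k i ∈ segreStar K n) (hB : ∀ k i, B k i ∈ segreStar K n)
    (h : A.expansion = B.expansion) : starOrbit A.toUnordered = starOrbit B.toUnordered := by
  obtain ⟨i₀⟩ : Nonempty (∀ k, Fin (r k)) := inferInstance
  let q (k : Fin m) (i : Fin (r k)) : Tensor K n := B k i * (A k i)⁻¹
  have hq_prod (i : ∀ k, Fin (r k)) : ∏ k, q k (i k) = 1 := by
    rw [Finset.prod_mul_distrib, ← Family.expansion, ← h, Family.expansion,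
      ← Finset.prod_mul_distrib]
    exact Finset.prod_eq_one fun k _ => mul_inv_cancel_of_mem_segreStar (hA k _)
  have hq (k : Fin m) (i : Fin (r k)) : q k (i₀ k) * A k i = B k i := by
    rw [apply_eq_apply_of_forall_prod_eq_one hq_prod k (i₀ k) i, mul_assoc, mul_comm (A k i)⁻¹,
      mul_inv_cancel_of_mem_segreStar (hA k i), mul_one]
  rw [← starOrbit_smul (D := fun k => q k (i₀ k))
    (fun k => mul_mem_segreStar (hB k _) (inv_mem_segreStar (hA k _))) (hq_prod i₀) A]
  simp only [hq]

theorem identifiable_of_forall_expansion_eq [∀ k, Nonempty (Fin (r k))] [Algebra K L]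
    {T : Tensor K n} (hT : T ∈ hhdTensors K n r) {t : (∀ k, Fin (r k)) → Tensor L n}
    (ht : ∀ i j, t i j ≠ 0)
    (h : ∀ A : Family K n r, IsHHD A T → ∃ B : Family K n r, A.toUnordered = B.toUnordered ∧
      ∀ i j, algebraMap K L (B.expansion i j) = t i j) :
    Identifiable r T := by
  obtain ⟨A, hA⟩ := hT
  have hreorder (A : Family K n r) (hA : IsHHD A T) : ∃ B : Family K n r,
      A.toUnordered = B.toUnordered ∧ (∀ k i, B k i ∈ segreStar K n) ∧
      ∀ i j, algebraMap K L (B.expansion i j) = t i j := by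
    obtain ⟨B, hAB, hBt⟩ := h A hA
    have hne (i j) : B.expansion i j ≠ 0 := fun h0 => ht i j (by rw [← hBt, h0, map_zero])
    exact ⟨B, hAB, fun k i => ⟨(hA.of_toUnordered_eq hAB).1 k i, fun j =>
      Family.apply_ne_zero_of_expansion_ne_zero (fun i => hne i j) k i⟩, hBt⟩
  refine ⟨starOrbit A.toUnordered, Set.eq_singleton_iff_unique_mem.2 ⟨⟨_, ⟨A, hA, rfl⟩, rfl⟩, ?_⟩⟩
  rintro _ ⟨_, ⟨B, hB, rfl⟩, rfl⟩
  obtain ⟨A', hAA', hA', hA't⟩ := hreorder A hA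
  obtain ⟨B', hBB', hB', hB't⟩ := hreorder B hB
  rw [hAA', hBB', starOrbit_eq_of_expansion_eq hB' hA' (funext fun i => funext fun j =>
    (algebraMap K L).injective ((hB't i j).trans (hA't i j).symm))]

end Expansion

section GenericFilter

open MvPolynomial

variable (K L σ : Type*) [Field K] [Field L] [Algebra K L]

/-- The filter of generic properties of points with coordinates in an extension `L` of `K`: those
that hold outside of some hypersurface defined over `K`. -/
def genericFilter : Filter (σ → L) where
  sets := {s | ∃ g : MvPolynomial σ K, g ≠ 0 ∧ ∀ p, aeval p g ≠ 0 → p ∈ s}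
  univ_sets := ⟨1, one_ne_zero, fun _ _ => trivial⟩
  sets_of_superset := fun ⟨g, hg, hgs⟩ hst => ⟨g, hg, fun p hp => hst (hgs p hp)⟩
  inter_sets := by
    rintro s t ⟨g, hg, hgs⟩ ⟨h, hh, hht⟩
    refine ⟨g * h, mul_ne_zero hg hh, fun p hp => ?_⟩
    rw [map_mul, mul_ne_zero_iff] at hp
    exact ⟨hgs p hp.1, hht p hp.2⟩

variable {K σ}

theorem eventually_aeval_ne_zero {g : MvPolynomial σ K} (hg : g ≠ 0) :
    ∀ᶠ p in genericFilter K L σ, aeval p g ≠ 0 :=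
  ⟨g, hg, fun _ h => h⟩

end GenericFilter

section Param

variable {d m : ℕ} {n : Fin d → ℕ} {r : Fin m → ℕ}

/-- The index set of the coordinates of the vectors whose tensor products form a family: the point
`⟨k, i, x, a⟩` is the coordinate `a` of the vector in mode `x` of the `i`-th tensor of the `k`-th
factor. -/
abbrev Param {d m : ℕ} (n : Fin d → ℕ) (r : Fin m → ℕ) : Type :=
  Σ k : Fin m, Fin (r k) × Σ x : Fin d, Fin (n x)

/-- The family of decomposable tensors with the given coordinates. -/
def paramFamily {K : Type*} [Field K] (p : Param n r → K) : Family K n r :=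
  fun k i => outer fun x a => p ⟨k, i, x, a⟩

/-- The Hadamard product of the sums of the decomposable tensors with the given coordinates. It
makes sense over any commutative semiring, in particular for indeterminate coordinates. -/
def paramTensor {A : Type*} [CommSemiring A] (p : Param n r → A) : Tensor A n :=
  fun j => ∏ k, ∑ i, ∏ x, p ⟨k, i, x, j x⟩

/-- The factor contributed by the modes in `X` to the term with multi-index `i` of the expanded
product of sums. -/
def modeVec {A : Type*} [CommSemiring A] (X : Finset (Fin d)) (p : Param n r → A)
    (i : ∀ k, Fin (r k)) : Tensor A n :=
  fun j => ∏ x ∈ X, ∏ k, p ⟨k, i k, x, j x⟩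

section CommSemiring

variable {A B : Type*} [CommSemiring A] [CommSemiring B]

theorem map_paramTensor (f : A →+* B) (p : Param n r → A) (j : ∀ x, Fin (n x)) :
    f (paramTensor p j) = paramTensor (f ∘ p) j := by
  simp [paramTensor]

theorem map_modeVec (f : A →+* B) (X : Finset (Fin d)) (p : Param n r → A) (i : ∀ k, Fin (r k))
    (j : ∀ x, Fin (n x)) : f (modeVec X p i j) = modeVec X (f ∘ p) i j := by
  simp [modeVec]

open MvPolynomial

variable [Algebra A B]

theorem aeval_modeVec_X (p : Param n r → B) (X : Finset (Fin d)) (i : ∀ k, Fin (r k))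
    (j : ∀ x, Fin (n x)) :
    aeval p (modeVec X (MvPolynomial.X : _ → MvPolynomial (Param n r) A) i j) =
      modeVec X p i j := by
  simp [modeVec]

theorem aeval_paramTensor_X (p : Param n r → B) (j : ∀ x, Fin (n x)) :
    aeval p (paramTensor (X : _ → MvPolynomial (Param n r) A) j) = paramTensor p j := by
  simp [paramTensor]

theorem aeval_aeval_paramTensor_X (p : Param n r → B) (f : MvPolynomial (∀ x, Fin (n x)) A) :
    aeval p (aeval (paramTensor (X : _ → MvPolynomial (Param n r) A)) f) =
      aeval (paramTensor p) f := by
  rw [← AlgHom.comp_apply, comp_aeval]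
  simp only [aeval_paramTensor_X]

end CommSemiring

variable {K : Type*} [Field K]

theorem prod_sum_paramFamily (p : Param n r → K) : ∏ k, ∑ i, paramFamily p k i = paramTensor p := by
  ext j
  simp [paramFamily, paramTensor, outer, Finset.prod_apply]

theorem expansion_paramFamily_apply (p : Param n r → K) (i : ∀ k, Fin (r k))
    (j : ∀ x, Fin (n x)) : (paramFamily p).expansion i j = modeVec Finset.univ p i j := by
  simp only [Family.expansion, paramFamily, outer, Finset.prod_apply, modeVec]
  exact Finset.prod_comm

theorem map_expansion_paramFamily {L : Type*} [Field L] (f : K →+* L) (p : Param n r → K)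
    (i : ∀ k, Fin (r k)) (j : ∀ x, Fin (n x)) :
    f ((paramFamily p).expansion i j) = (paramFamily (f ∘ p)).expansion i j := by
  simp only [expansion_paramFamily_apply, map_modeVec]

theorem IsHHD.exists_eq_paramFamily {A : Family K n r} {T : Tensor K n} (hA : IsHHD A T) :
    ∃ p, A = paramFamily p ∧ T = paramTensor p := by
  choose a ha using fun k i => (hA.1 k i).2
  obtain rfl : A = paramFamily fun q => a q.1 q.2.1 q.2.2.1 q.2.2.2 :=
    funext fun k => funext fun i => ha k i
  exact ⟨_, rfl, hA.2.trans (prod_sum_paramFamily _)⟩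

theorem paramTensor_mem_hhdTensors [∀ x, NeZero (n x)] {p : Param n r → K} (hp : ∀ q, p q ≠ 0) :
    paramTensor p ∈ hhdTensors K n r :=
  ⟨paramFamily p, fun k i => ⟨Function.ne_iff.2 ⟨0, show ∏ x, p ⟨k, i, x, 0⟩ ≠ 0 from
    Finset.prod_ne_zero_iff.2 fun _ _ => hp _⟩, _, rfl⟩, (prod_sum_paramFamily p).symm⟩

open MvPolynomial in
theorem hhdVariety_subset_zeroLocus_ker : hhdVariety K n r ⊆ zeroLocus K (RingHom.ker
    (aeval (paramTensor X) :
      MvPolynomial (∀ x, Fin (n x)) K →ₐ[K] MvPolynomial (Param n r) K)) := by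
  refine fun T hT f hf => hT f ?_
  rintro _ ⟨A, hA⟩
  obtain ⟨p, -, rfl⟩ := hA.exists_eq_paramFamily
  rw [← aeval_aeval_paramTensor_X, (RingHom.mem_ker).1 hf, map_zero]

open MvPolynomial in
theorem exists_mem_hhdTensors_aeval_ne_zero [Infinite K] [∀ x, NeZero (n x)]
    {f : MvPolynomial (∀ x, Fin (n x)) K}
    (hf : aeval (paramTensor (X : _ → MvPolynomial (Param n r) K)) f ≠ 0) :
    ∃ T ∈ hhdTensors K n r, aeval T f ≠ 0 := by
  have hprod : (∏ q, X q : MvPolynomial (Param n r) K) ≠ 0 :=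
    Finset.prod_ne_zero_iff.2 fun q _ => X_ne_zero q
  obtain ⟨p, hp⟩ : ∃ p : Param n r → K,
      aeval p (aeval (paramTensor X) f * ∏ q, X q : MvPolynomial (Param n r) K) ≠ 0 := by
    by_contra! h
    exact mul_ne_zero hf hprod (MvPolynomial.funext fun p => by simpa [aeval_eq_eval] using h p)
  rw [map_mul, aeval_aeval_paramTensor_X, mul_ne_zero_iff, map_prod, Finset.prod_ne_zero_iff] at hp
  exact ⟨_, paramTensor_mem_hhdTensors fun q => by simpa using hp.2 q (Finset.mem_univ q), hp.1⟩

end Param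

section Genericity

variable {d m : ℕ} {n : Fin d → ℕ} {r : Fin m → ℕ} {K : Type*} [Field K]

theorem exists_weights [∀ x, NeZero (n x)] (X : Finset (Fin d)) :
    ∃ w : Fin d → ℕ, ∀ t < dimProd n X, ∃ j : ∀ x, Fin (n x), ∑ x ∈ X, w x * j x = t := by
  let n' (x : Fin d) : ℕ := if x ∈ X then n x else 1
  have hle (x : Fin d) : n' x ≤ n x := by
    simp only [n']
    split_ifs
    exacts [le_rfl, NeZero.pos (n x)]
  have hprod : ∏ x, n' x = dimProd n X := by simp [n', dimProd]
  refine ⟨fun x => ∏ l, n' (Fin.castLE x.is_lt.le l), fun t ht => ?_⟩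
  let j : ∀ x, Fin (n' x) := finPiFinEquiv.symm ⟨t, hprod.symm ▸ ht⟩
  have hj : (finPiFinEquiv j : ℕ) = t := by simp [j]
  refine ⟨fun x => Fin.castLE (hle x) (j x), ?_⟩
  rw [← hj, finPiFinEquiv_apply, ← Finset.sum_subset X.subset_univ fun x _ hx => ?_]
  · simp only [Fin.val_castLE, mul_comm]
  · have : n' x = 1 := if_neg hx
    have := (j x).isLt
    simp [show (j x : ℕ) = 0 by omega]

theorem exists_modeVec_eq_X_pow (X : Finset (Fin d)) (w : Fin d → ℕ) :
    ∃ s : Param n r → Polynomial K, ∀ i j,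
      modeVec X s i j = (Polynomial.X ^ (finPiFinEquiv i : ℕ)) ^ ∑ x ∈ X, w x * (j x : ℕ) := by
  refine ⟨fun q => Polynomial.X ^ ((q.2.1 * ∏ l : Fin q.1, r (Fin.castLE q.1.is_lt.le l)) *
    (w q.2.2.1 * q.2.2.2) : ℕ), fun i j => ?_⟩
  rw [← pow_mul, finPiFinEquiv_apply, Finset.sum_mul_sum, Finset.sum_comm]
  simp only [modeVec, Finset.prod_pow_eq_pow_sum]

theorem det_modeVec_X_ne_zero (X : Finset (Fin d)) {k : ℕ} {e : Fin k → ∀ k, Fin (r k)}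
    (he : Function.Injective e) {w : Fin d → ℕ} {c : Fin k → ∀ x, Fin (n x)}
    (hc : ∀ b : Fin k, ∑ x ∈ X, w x * (c b x : ℕ) = b) :
    (Matrix.of fun a b => modeVec X (MvPolynomial.X : _ → MvPolynomial (Param n r) K)
      (e a) (c b)).det ≠ 0 := by
  obtain ⟨s, hs⟩ := exists_modeVec_eq_X_pow (n := n) (r := r) (K := K) X w
  intro hdet
  have hvandermonde : (MvPolynomial.aeval s).mapMatrix (Matrix.of fun a b =>
      modeVec X (MvPolynomial.X : _ → MvPolynomial (Param n r) K) (e a) (c b)) =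
      Matrix.vandermonde fun a => (Polynomial.X : Polynomial K) ^ (finPiFinEquiv (e a) : ℕ) := by
    ext1 a b
    simp only [AlgHom.mapMatrix_apply, Matrix.map_apply, Matrix.of_apply, aeval_modeVec_X, hs, hc,
      Matrix.vandermonde_apply]
  have hinj : Function.Injective
      fun a => (Polynomial.X : Polynomial K) ^ (finPiFinEquiv (e a) : ℕ) := fun a b hab =>
    he (finPiFinEquiv.injective (Fin.ext (by simpa using congrArg Polynomial.natDegree hab)))
  refine Matrix.det_vandermonde_ne_zero_iff.2 hinj ?_
  rw [← hvandermonde, ← AlgHom.map_det, hdet, map_zero]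

variable (L : Type*) [Field L] [Algebra K L] [∀ x, NeZero (n x)]

theorem eventually_linearIndepOn_modeVec (X : Finset (Fin d)) {S : Finset (∀ k, Fin (r k))}
    (hS : S.card ≤ dimProd n X) :
    ∀ᶠ p in genericFilter K L (Param n r), LinearIndepOn L (modeVec X p) (S : Set _) := by
  obtain ⟨w, hw⟩ := exists_weights (n := n) X
  choose c hc using fun b : Fin S.card => hw b (b.isLt.trans_le hS)
  let e := S.equivFin.symm
  have hdet := det_modeVec_X_ne_zero (K := K) X (Subtype.val_injective.comp e.injective) hc
  refine (eventually_aeval_ne_zero L hdet).mono fun p hp => ?_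
  have hdet' : (Matrix.of fun a b => modeVec X p (e a) (c b)).det ≠ 0 := by
    rw [AlgHom.map_det] at hp
    convert hp using 2
    exact Matrix.ext fun a b => (aeval_modeVec_X p X (e a) (c b)).symm
  have hrows : LinearIndependent L fun a b => modeVec X p (e a) (c b) :=
    Matrix.linearIndependent_rows_of_det_ne_zero hdet'
  exact (linearIndependent_equiv e).1 (LinearIndependent.of_comp (LinearMap.funLeft L L c) hrows)

theorem eventually_hasKruskalRank_modeVec (X : Finset (Fin d)) :
    ∀ᶠ p in genericFilter K L (Param n r), HasKruskalRank L (dimProd n X) (modeVec X p) :=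
  Filter.eventually_all.2 fun _ => Filter.eventually_imp_distrib_left.2
    (eventually_linearIndepOn_modeVec L X)

theorem eventually_samePairs_of_modeVec_mul_modeVec_eq [NeZero d] :
    ∀ᶠ p in genericFilter K L (Param n r), ∀ i j i' j' : ∀ k, Fin (r k),
      modeVec Finset.univ p i * modeVec Finset.univ p j =
        modeVec Finset.univ p i' * modeVec Finset.univ p j' → SamePairs i j i' j' := by
  simp only [Filter.eventually_all]
  intro i j i' j'
  let M (i : ∀ k, Fin (r k)) : MvPolynomial (Param n r) K :=
    modeVec Finset.univ MvPolynomial.X i 0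
  -- Keeping only the variables of the `k`-th factor in one entry of mode `0`, `M i` becomes the
  -- variable with index `i k`.
  have hpairs (h : M i * M j = M i' * M j') : SamePairs i j i' j' := fun k => by
    let s (q : Param n r) : MvPolynomial (Σ k, Fin (r k)) K :=
      if q.1 = k ∧ q.2.2.1 = 0 then MvPolynomial.X ⟨q.1, q.2.1⟩ else 1
    have hM (i : ∀ k, Fin (r k)) : MvPolynomial.aeval s (M i) = MvPolynomial.X ⟨k, i k⟩ := by
      rw [aeval_modeVec_X, modeVec, Fintype.prod_eq_single 0 fun x hx => by simp [s, hx],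
        Fintype.prod_eq_single k fun l hl => by simp [s, hl]]
      simp [s]
    have hX := congrArg (MvPolynomial.aeval s) h
    simp only [map_mul, hM, MvPolynomial.X, MvPolynomial.monomial_mul, mul_one] at hX
    have hsingle := MvPolynomial.monomial_left_injective one_ne_zero hX
    rw [Finsupp.single_add_single_eq_single_add_single one_ne_zero one_ne_zero] at hsingle
    simpa [Sym2.eq_iff] using hsingle
  by_cases h : SamePairs i j i' j'
  · exact Filter.Eventually.of_forall fun _ _ => h
  refine (eventually_aeval_ne_zero L (sub_ne_zero.2 (mt hpairs h))).mono fun p hp heq => ?_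
  refine absurd ?_ hp
  simp only [M, map_sub, map_mul, aeval_modeVec_X, sub_eq_zero]
  exact congrFun heq 0

end Genericity

section KruskalPartition

variable {d : ℕ} {n : Fin d → ℕ}

/-- A partition `I ⊔ J ⊔ M` of the modes such that Kruskal's criterion applies to the expressions as
sums of `R` terms of tensors that are general enough, when these are regarded as tensors with the
three modes `I`, `J`, `M`. A nonzero tensor is the only expression of itself as a sum of one term,
hence no condition is needed for `R ≤ 1`. -/
structure IsKruskalPartition (n : Fin d → ℕ) (R : ℕ) (I J M : Finset (Fin d)) : Prop where
  disjoint : Disjoint I J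
  disjoint_union : Disjoint (I ∪ J) M
  union_eq_univ : I ∪ J ∪ M = Finset.univ
  two_mul_add_two_le (hR : 2 ≤ R) :
    2 * R + 2 ≤ min R (dimProd n I) + min R (dimProd n J) + min R (dimProd n M)

theorem InKruskalRange.exists_isKruskalPartition {R : ℕ} (h : InKruskalRange n R) :
    ∃ I J M, IsKruskalPartition n R I J M := by
  obtain ⟨I, J, M, hIJ, hIM, hJM, hU, hJI, hMJ, hM, hR⟩ := h
  refine ⟨I, J, M, hIJ, Finset.disjoint_union_left.2 ⟨hIM, hJM⟩, hU, fun h2 => ?_⟩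
  rw [← sub_le_iff_le_add', le_min_iff] at hR
  have hsum : (2 * R + 2 : ℚ) ≤ dimProd n I + dimProd n J + dimProd n M := by
    linarith [hR.1, kruskalDelta.eq_1 n I J M]
  have hsum' : (R + 2 : ℚ) ≤ dimProd n J + dimProd n M := by
    linarith [hR.2, kruskalDelta.eq_1 n I J M]
  norm_cast at hsum hsum'
  omega

theorem InKruskalRange.dimension_ne_zero {R : ℕ} (h : InKruskalRange n R) (x : Fin d) :
    n x ≠ 0 := by
  obtain ⟨I, J, M, -, -, -, hU, hJI, hMJ, hM, -⟩ := h
  have hne {X : Finset (Fin d)} (hX : 2 ≤ dimProd n X) (hx : x ∈ X) : n x ≠ 0 :=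
    Finset.prod_ne_zero_iff.1 (two_pos.trans_le hX).ne' x hx
  have hx : x ∈ I ∪ J ∪ M := hU ▸ Finset.mem_univ x
  rcases by simpa only [Finset.mem_union] using hx with (hx | hx) | hx
  exacts [hne (hM.trans (hMJ.trans hJI)) hx, hne (hM.trans hMJ) hx, hne hM hx]

theorem InKruskalRange.modes_ne_zero {R : ℕ} (h : InKruskalRange n R) : d ≠ 0 := by
  rintro rfl
  obtain ⟨I, J, M, -, -, -, -, -, -, hM, -⟩ := h
  simp [dimProd, Finset.eq_empty_of_isEmpty M] at hM

end KruskalPartition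

section Identifiability

variable {d m : ℕ} {n : Fin d → ℕ} {r : Fin m → ℕ} {K L : Type*} [Field K] [Field L]
  {I J M : Finset (Fin d)} {p : Param n r → L}

theorem IsKruskalPartition.modeVec_mul {R : ℕ} (h : IsKruskalPartition n R I J M)
    (p : Param n r → L) (i : ∀ k, Fin (r k)) (j₁ j₂ j₃ : ∀ x, Fin (n x)) :
    modeVec I p i j₁ * (modeVec J p i j₂ * modeVec M p i j₃) =
      modeVec Finset.univ p i (I.piecewise j₁ (J.piecewise j₂ j₃)) := by
  have hJ : ∀ x ∈ J, x ∉ I := fun x hx hx' => Finset.disjoint_left.1 h.disjoint hx' hx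
  have hM : ∀ x ∈ M, x ∉ I ∧ x ∉ J := fun x hx => by
    simpa using Finset.disjoint_right.1 h.disjoint_union hx
  simp only [modeVec]
  rw [← h.union_eq_univ, Finset.prod_union h.disjoint_union, Finset.prod_union h.disjoint,
    mul_assoc]
  congr 1
  · exact Finset.prod_congr rfl fun x hx => by simp [hx]
  congr 1
  · exact Finset.prod_congr rfl fun x hx => by simp [hx, hJ x hx]
  · exact Finset.prod_congr rfl fun x hx => by simp [hM x hx]

theorem IsKruskalPartition.productFamily_modeVec_apply {R : ℕ} (h : IsKruskalPartition n R I J M)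
    (p : Param n r → L) (i : ∀ k, Fin (r k)) (j₁ j₂ j₃ : ∀ x, Fin (n x)) :
    productFamily (modeVec I p) (productFamily (modeVec J p) (modeVec M p)) i j₁ j₂ j₃ =
      (paramFamily p).expansion i (I.piecewise j₁ (J.piecewise j₂ j₃)) := by
  rw [expansion_paramFamily_apply, ← h.modeVec_mul]
  rfl

/-- The conditions on the coordinates of a family under which the terms of the expansion of its
product of sums are determined, up to a permutation, by their sum, and determine the factors. -/
structure IsGeneric (I J M : Finset (Fin d)) (p : Param n r → L) : Prop where
  ne_zero : ∀ q, p q ≠ 0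
  hasKruskalRank_fst : HasKruskalRank L (dimProd n I) (modeVec I p)
  hasKruskalRank_snd : HasKruskalRank L (dimProd n J) (modeVec J p)
  hasKruskalRank_trd : HasKruskalRank L (dimProd n M) (modeVec M p)
  samePairs : ∀ i j i' j' : ∀ k, Fin (r k),
    modeVec Finset.univ p i * modeVec Finset.univ p j =
      modeVec Finset.univ p i' * modeVec Finset.univ p j' → SamePairs i j i' j'

theorem eventually_isGeneric [NeZero d] [∀ x, NeZero (n x)] [Algebra K L]
    (I J M : Finset (Fin d)) :
    ∀ᶠ p in genericFilter K L (Param n r), IsGeneric I J M p := by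
  have hne : ∀ᶠ p in genericFilter K L (Param n r), ∀ q, p q ≠ 0 :=
    Filter.eventually_all.2 fun q => by
      simpa using eventually_aeval_ne_zero L (MvPolynomial.X_ne_zero (R := K) q)
  filter_upwards [hne, eventually_hasKruskalRank_modeVec L I, eventually_hasKruskalRank_modeVec L J,
    eventually_hasKruskalRank_modeVec L M, eventually_samePairs_of_modeVec_mul_modeVec_eq L]
    with p h₀ h₁ h₂ h₃ h₄
  exact ⟨h₀, h₁, h₂, h₃, h₄⟩

namespace IsGeneric

theorem expansion_apply_ne_zero (hp : IsGeneric I J M p) (i : ∀ k, Fin (r k))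
    (j : ∀ x, Fin (n x)) : (paramFamily p).expansion i j ≠ 0 := by
  rw [expansion_paramFamily_apply]
  exact Finset.prod_ne_zero_iff.2 fun x _ => Finset.prod_ne_zero_iff.2 fun k _ => hp.ne_zero _

theorem exists_perm_expansion_eq [∀ x, NeZero (n x)] (hp : IsGeneric I J M p)
    (h : IsKruskalPartition n (∏ k, r k) I J M) {p' : Param n r → L}
    (hpp' : paramTensor p' = paramTensor p) :
    ∃ σ : Equiv.Perm (∀ k, Fin (r k)),
      (paramFamily p').expansion = (paramFamily p).expansion ∘ σ := by
  have hsum : ∑ i, (paramFamily p).expansion i = ∑ i, (paramFamily p').expansion i := by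
    simp only [Family.sum_expansion, prod_sum_paramFamily, hpp']
  obtain ⟨σ, hσ⟩ := exists_perm_of_sum_productFamily_eq (u' := modeVec I p') (v' := modeVec J p')
    (w' := modeVec M p') (fun i h0 => hp.expansion_apply_ne_zero i _
      ((h.productFamily_modeVec_apply p i 0 0 0).symm.trans (by rw [h0]; rfl)))
    hp.hasKruskalRank_fst hp.hasKruskalRank_snd hp.hasKruskalRank_trd
    (by simpa using h.two_mul_add_two_le) (by
      ext j₁ j₂ j₃
      simpa only [Finset.sum_apply, h.productFamily_modeVec_apply] using congrFun hsum _)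
  refine ⟨σ, funext fun i => funext fun j => ?_⟩
  have hij := h.productFamily_modeVec_apply p' i j j j
  rw [hσ, Function.comp_apply, h.productFamily_modeVec_apply] at hij
  simpa only [Finset.piecewise_same, Function.comp_apply] using hij.symm

theorem identifiable [∀ x, NeZero (n x)] [∀ k, Nontrivial (Fin (r k))] [Algebra K L]
    (hp : IsGeneric I J M p) (h : IsKruskalPartition n (∏ k, r k) I J M) {T : Tensor K n}
    (hT : T ∈ hhdTensors K n r) (hpT : ∀ j, paramTensor p j = algebraMap K L (T j)) :
    Identifiable r T := by
  refine identifiable_of_forall_expansion_eq hT hp.expansion_apply_ne_zero fun A hA => ?_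
  obtain ⟨a, rfl, rfl⟩ := hA.exists_eq_paramFamily
  obtain ⟨σ, hσ⟩ := hp.exists_perm_expansion_eq h (p' := algebraMap K L ∘ a)
    (funext fun j => by rw [hpT, map_paramTensor])
  have hexp (i j) : algebraMap K L ((paramFamily a).expansion i j) =
      (paramFamily p).expansion (σ i) j := by rw [map_expansion_paramFamily, hσ]; rfl
  have hpairs : ∀ i j i' j', SamePairs i j i' j' → SamePairs (σ i) (σ j) (σ i') (σ j') := by
    intro i j i' j' hij
    refine hp.samePairs _ _ _ _ (funext fun x => ?_)
    simp only [Pi.mul_apply, ← expansion_paramFamily_apply, ← hexp, ← map_mul]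
    exact congrArg _ (congrFun ((paramFamily a).expansion_mul_expansion_of_samePairs hij) x)
  obtain ⟨ψ, π, rfl⟩ := exists_eq_piCongr_of_map_samePairs σ hpairs
  obtain ⟨B, hAB, hB⟩ := (paramFamily a).exists_toUnordered_eq_and_expansion_comp_piCongr ψ π
  refine ⟨B, hAB, fun i j => ?_⟩
  obtain ⟨i, rfl⟩ := (ψ.piCongr π).surjective i
  rw [← hexp, ← hB]
  rfl

end IsGeneric

open MvPolynomial in
theorem exists_forall_mem_hhdVariety_exists_isGeneric [NeZero d] [∀ x, NeZero (n x)]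
    (I J M : Finset (Fin d)) : ∃ f : MvPolynomial (∀ x, Fin (n x)) K,
      aeval (paramTensor (X : _ → MvPolynomial (Param n r) K)) f ≠ 0 ∧
      ∀ T ∈ hhdVariety K n r, aeval T f ≠ 0 → ∃ p : Param n r → AlgebraicClosure K,
        IsGeneric I J M p ∧ ∀ j, paramTensor p j = algebraMap K _ (T j) := by
  obtain ⟨g, hg, hgeneric⟩ := eventually_isGeneric (n := n) (r := r) (K := K)
    (L := AlgebraicClosure K) I J M
  obtain ⟨f, hf, hlift⟩ := exists_forall_mem_zeroLocus_exists_lift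
    (paramTensor (X : _ → MvPolynomial (Param n r) K)) hg
  refine ⟨f, hf, fun T hT hTf => ?_⟩
  obtain ⟨p, hpg, hpT⟩ := hlift T (hhdVariety_subset_zeroLocus_ker hT) hTf (AlgebraicClosure K)
  exact ⟨p, hgeneric p hpg, fun j => by rw [← hpT, aeval_paramTensor_X]⟩

theorem mem_hhdTensors_of_paramTensor_eq_algebraMap [IsAlgClosed K] [Algebra K L]
    [Algebra.IsIntegral K L] [∀ x, NeZero (n x)] (hp : ∀ q, p q ≠ 0) {T : Tensor K n}
    (hpT : ∀ j, paramTensor p j = algebraMap K L (T j)) : T ∈ hhdTensors K n r := by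
  choose a ha using fun q => (IsAlgClosed.algebraMap_bijective_of_isIntegral (k := K)).2 (p q)
  obtain rfl : algebraMap K L ∘ a = p := funext ha
  obtain rfl : paramTensor a = T := funext fun j =>
    (algebraMap K L).injective ((map_paramTensor _ a j).trans (hpT j))
  exact paramTensor_mem_hhdTensors fun q => ne_zero_of_map (hp q)

end Identifiability

theorem isZariskiClosed_setOf_mem_zariskiClosure_and_aeval_eq_zero {K ι : Type*} [Field K]
    (V : Set (ι → K)) (f : MvPolynomial ι K) :
    IsZariskiClosed {x | x ∈ zariskiClosure V ∧ MvPolynomial.aeval x f = 0} := by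
  refine ⟨Ideal.span (insert f (MvPolynomial.vanishingIdeal K V)), ?_⟩
  ext x
  rw [MvPolynomial.zeroLocus_span, Set.mem_ofPred_eq, Set.mem_ofPred_eq, Set.forall_mem_insert,
    and_comm]
  rfl

end HHD

theorem mainTheorem3_general {K : Type*} [Field K] [Infinite K] {d m : ℕ}
    (n : Fin d → ℕ) (r : Fin m → ℕ) (hr : ∀ k, 2 ≤ r k)
    (hR : HHD.InKruskalRange n (∏ k, r k)) :
    ∃ Z : Set (HHD.Tensor K n),
      HHD.IsZariskiClosed Z ∧ Z ⊂ HHD.hhdVariety K n r ∧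
      (∀ T ∈ HHD.hhdTensors K n r, T ∉ Z → HHD.Identifiable r T) ∧
      (IsAlgClosed K → ∀ T ∈ HHD.hhdVariety K n r, T ∉ Z → HHD.Identifiable r T) := by
  have (k : Fin m) : Nontrivial (Fin (r k)) := Fin.nontrivial_iff_two_le.2 (hr k)
  have (x : Fin d) : NeZero (n x) := ⟨hR.dimension_ne_zero x⟩
  have : NeZero d := ⟨hR.modes_ne_zero⟩
  obtain ⟨I, J, M, hIJM⟩ := hR.exists_isKruskalPartition
  obtain ⟨f, hf, hgeneric⟩ :=
    HHD.exists_forall_mem_hhdVariety_exists_isGeneric (K := K) (n := n) (r := r) I J M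
  have hsub : HHD.hhdTensors K n r ⊆ HHD.hhdVariety K n r :=
    MvPolynomial.zeroLocus_vanishingIdeal_le _
  refine ⟨{T | T ∈ HHD.hhdVariety K n r ∧ MvPolynomial.aeval T f = 0},
    HHD.isZariskiClosed_setOf_mem_zariskiClosure_and_aeval_eq_zero _ f,
    ⟨fun T hT => hT.1, fun hZ => ?_⟩, fun T hT hTZ => ?_, fun _ T hT hTZ => ?_⟩
  · obtain ⟨T, hT, hTf⟩ := HHD.exists_mem_hhdTensors_aeval_ne_zero hf
    exact hTf (hZ (hsub hT)).2
  · obtain ⟨p, hp, hpT⟩ := hgeneric T (hsub hT) fun h0 => hTZ ⟨hsub hT, h0⟩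
    exact hp.identifiable hIJM hT hpT
  · obtain ⟨p, hp, hpT⟩ := hgeneric T hT fun h0 => hTZ ⟨hT, h0⟩
    exact hp.identifiable hIJM (HHD.mem_hhdTensors_of_paramTensor_eq_algebraMap hp.ne_zero hpT) hpT

theorem mainTheorem3 {K : Type*} [Field K] [CharZero K] {d m : ℕ}
    (n : Fin d → ℕ) (r : Fin m → ℕ) (hr : ∀ k, 2 ≤ r k)
    (hR : HHD.InKruskalRange n (∏ k, r k)) :
    ∃ Z : Set (HHD.Tensor K n),
      HHD.IsZariskiClosed Z ∧ Z ⊂ HHD.hhdVariety K n r ∧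
      (∀ T ∈ HHD.hhdTensors K n r, T ∉ Z → HHD.Identifiable r T) ∧
      (IsAlgClosed K → ∀ T ∈ HHD.hhdVariety K n r, T ∉ Z → HHD.Identifiable r T) := by
  have := CharZero.infinite K
  exact mainTheorem3_general n r hr hR
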